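/- Let $K$ be a number field with ring of integers $\mathcal O$, let $\mathfrak p$ be a nonzero prime ideal of $\mathcal O$, put $q=|\mathcal O:\mathfrak p|$, and let $\mathfrak o$ be the completion of $\mathcal O$ at $\mathfrak p$, with maximal ideal again denoted $\mathfrak p$. For a commutative ring $R$ let $\mathbf H(R)$ be the Heisenberg group of upper unitriangular $3\times 3$-matrices over $R$, and write $\mathbf H_N=\mathbf H(\mathfrak o/\mathfrak p^N)$ for $N\ge 0$. For a finite group $G$ let $r_n(G)$ be the number of isomorphism classes of $n$-dimensional irreducible complex representations of $G$, let $c_n(G)$ be the number of conjugacy classes of $G$ of cardinality $n$, let $\mathrm k(G)$ be the number of conjugacy classes of $G$, and put $\zeta^{\mathrm{irr}}_G(s)=\sum_{n\ge 1}r_n(G)n^{-s}$, $\zeta^{\mathrm{cc}}_G(s)=\sum_{n\ge 1}c_n(G)n^{-s}$. For $\ast\in\{\mathrm{irr},\mathrm{cc}\}$ let $$\mathcal Z^{\ast}_{\mathbf H(\mathfrak o)}(s_1,s_2)=\sum_{N\ge 0}\zeta^{\ast}_{\mathbf H_N}(s_1)\,q^{-Ns_2},\qquad \zeta^{\mathrm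 k}_{\mathbf H(\mathfrak o)}(s)=\sum_{N\ge 0}\mathrm k(\mathbf H_N)\,q^{-Ns}.$$ For $n\ge 1$ let $\widetilde r_n$ be the number of classes of $n$-dimensional continuous irreducible complex representations of $\mathbf H(\mathfrak o)$ under the relation $\rho\sim\sigma$ if and only if $\rho\cong\chi\otimes\sigma$ for some continuous one-dimensional representation $\chi$, and let $\zeta^{\widetilde{\mathrm{irr}}}_{\mathbf H(\mathfrak o)}(s)=\sum_{n\ge 1}\widetilde r_n n^{-s}$. Then the following hold. 1. If $\mathrm{Re}(s_2)>2$ and $\mathrm{Re}(s_1+s_2)>1$, the series $\mathcal Z^{\mathrm{irr}}_{\mathbf H(\mathfrak o)}(s_1,s_2)$ converges absolutely and $$\mathcal Z^{\mathrm{irr}}_{\mathbf H(\mathfrak o)}(s_1,s_2)=\frac{1-q^{-s_1-s_2}}{(1-q^{1-s_1-s_2})(1-q^{2-s_2})}.$$ 2. If $\mathrm{Re}(s_2)>1$ and $\mathrm{Re}(s_1+s_2)>2$, the series $\mathcal Z^{\mathrm{cc}}_{\mathbf H(\mathfrak o)}(s_1,s_2)$ converges absolutely and $$\mathcal Z^{\mathrm{cc}}_{\mathbf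 H(\mathfrak o)}(s_1,s_2)=\frac{1-q^{-s_1-s_2}}{(1-q^{1-s_2})(1-q^{2-s_1-s_2})}.$$ 3. If $\mathrm{Re}(s)>2$, the series $\zeta^{\mathrm k}_{\mathbf H(\mathfrak o)}(s)$ converges absolutely and $$\mathcal Z^{\mathrm{irr}}_{\mathbf H(\mathfrak o)}(0,s)=\mathcal Z^{\mathrm{cc}}_{\mathbf H(\mathfrak o)}(0,s)=\zeta^{\mathrm k}_{\mathbf H(\mathfrak o)}(s)=\frac{1-q^{-s}}{(1-q^{1-s})(1-q^{2-s})}.$$ 4. Every $\widetilde r_n$ is finite and, if $\mathrm{Re}(s)>1$, the series $\zeta^{\widetilde{\mathrm{irr}}}_{\mathbf H(\mathfrak o)}(s)$ converges absolutely and $$\lim_{s_2\to 2,\ \mathrm{Re}(s_2)>2}(1-q^{2-s_2})\,\mathcal Z^{\mathrm{irr}}_{\mathbf H(\mathfrak o)}(s-2,s_2)=\zeta^{\widetilde{\mathrm{irr}}}_{\mathbf H(\mathfrak o)}(s)=\frac{1-q^{-s}}{1-q^{1-s}}.$$ 5. On these domains $\mathcal Z^{\mathrm{irr}}_{\mathbf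 H(\mathfrak o)}$, $\mathcal Z^{\mathrm{cc}}_{\mathbf H(\mathfrak o)}$ and $\zeta^{\mathrm k}_{\mathbf H(\mathfrak o)}$ are the values of the rational functions $$W^{\mathrm{irr}}=\frac{1-Y_1Y_2}{(1-XY_1Y_2)(1-X^2Y_2)},\quad W^{\mathrm{cc}}=\frac{1-Y_1Y_2}{(1-XY_2)(1-X^2Y_1Y_2)},\quad W^{\mathrm k}=\frac{1-Y}{(1-XY)(1-X^2Y)}$$ over $\mathbb Q$ at $(X,Y_1,Y_2)=(q,q^{-s_1},q^{-s_2})$, respectively $(X,Y)=(q,q^{-s})$. Under inversion of $q$ they satisfy the functional equations $W^{\ast}(X^{-1},Y_1^{-1},Y_2^{-1})=-X^3Y_2\,W^{\ast}(X,Y_1,Y_2)$ for $\ast\in\{\mathrm{irr},\mathrm{cc}\}$ and $W^{\mathrm k}(X^{-1},Y^{-1})=-X^3Y\,W^{\mathrm k}(X,Y)$; that is, $\mathcal Z^{\ast}_{\mathbf H(\mathfrak o)}(s_1,s_2)|_{q\to q^{-1}}=-q^{3-s_2}\mathcal Z^{\ast}_{\mathbf H(\mathfrak o)}(s_1,s_2)$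 and $\zeta^{\mathrm k}_{\mathbf H(\mathfrak o)}(s)|_{q\to q^{-1}}=-q^{3-s}\zeta^{\mathrm k}_{\mathbf H(\mathfrak o)}(s)$. -/

import Mathlib

open scoped NumberField

namespace HeisenbergZeta

noncomputable section

/-! ### The Heisenberg group scheme -/

/-- The Heisenberg group `H(R)`: upper unitriangular `3 × 3` matrices over `R`. -/
def Heisenberg (R : Type*) [CommRing R] : Subgroup (Matrix.SpecialLinearGroup (Fin 3) R) where
  carrier := {A | (∀ i, A i i = 1) ∧ ∀ i j, j < i → A i j = 0}
  one_mem' := by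
    refine ⟨fun i => by simp, fun i j h => ?_⟩
    simp [h.ne']
  mul_mem' := by
    rintro A B ⟨hA, hA'⟩ ⟨hB, hB'⟩
    have a10 := hA' 1 0 (by decide)
    have a20 := hA' 2 0 (by decide)
    have a21 := hA' 2 1 (by decide)
    have b10 := hB' 1 0 (by decide)
    have b20 := hB' 2 0 (by decide)
    have b21 := hB' 2 1 (by decide)
    refine ⟨fun i => ?_, fun i j h => ?_⟩
    · have h0 := hA i
      have h1 := hB i
      rw [Matrix.SpecialLinearGroup.coe_mul, Matrix.mul_apply, Fin.sum_univ_three]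
      fin_cases i <;> simp_all
    · rw [Matrix.SpecialLinearGroup.coe_mul, Matrix.mul_apply, Fin.sum_univ_three]
      fin_cases i <;> fin_cases j <;> simp_all
  inv_mem' := by
    rintro A ⟨hA, hA'⟩
    have a10 := hA' 1 0 (by decide)
    have a20 := hA' 2 0 (by decide)
    have a21 := hA' 2 1 (by decide)
    have a0 := hA 0
    have a1 := hA 1
    have a2 := hA 2
    refine ⟨fun i => ?_, fun i j h => ?_⟩
    · rw [Matrix.SpecialLinearGroup.coe_inv, Matrix.adjugate_fin_three]
      fin_cases i <;> simp_all
    · rw [Matrix.SpecialLinearGroup.coe_inv, Matrix.adjugate_fin_three]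
      fin_cases i <;> fin_cases j <;> simp_all

/-! ### Representation and conjugacy class zeta functions of finite groups -/

/-- Isomorphism of irreducible representations of `G` on `ℂⁿ`. -/
def irrSetoid (G : Type*) [Group G] (n : ℕ) :
    Setoid {ρ : Representation ℂ G (Fin n → ℂ) // ρ.IsIrreducible} where
  r ρ σ := Nonempty (ρ.1.Equiv σ.1)
  iseqv :=
    { refl := fun ρ => ⟨.refl ρ.1⟩
      symm := fun ⟨e⟩ => ⟨e.symm⟩
      trans := fun ⟨e⟩ ⟨f⟩ => ⟨e.trans f⟩ }

/-- `r_n(G)`: the number of isomorphism classes of `n`-dimensional irreducible complex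
representations of `G`. -/
def irrCount (G : Type*) [Group G] (n : ℕ) : ℕ := Nat.card (Quotient (irrSetoid G n))

/-- `c_n(G)`: the number of conjugacy classes of `G` of cardinality `n`. -/
def ccCount (G : Type*) [Group G] (n : ℕ) : ℕ :=
  Nat.card {C : ConjClasses G // Nat.card C.carrier = n}

/-- The class number `k(G)`. -/
def classNumber (G : Type*) [Group G] : ℕ := Nat.card (ConjClasses G)

/-- The representation zeta function `∑_{n ≥ 1} r_n(G) n^{-s}` of a finite group. -/
def zetaIrr (G : Type*) [Group G] (s : ℂ) : ℂ := LSeries (fun n => (irrCount G n : ℂ)) s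

/-- The conjugacy class zeta function `∑_{n ≥ 1} c_n(G) n^{-s}` of a finite group. -/
def zetaCC (G : Type*) [Group G] (s : ℂ) : ℂ := LSeries (fun n => (ccCount G n : ℂ)) s

/-! ### Twist-isoclasses of continuous irreducible representations -/

/-- Continuous irreducible complex representations of a topological group `G` on `ℂⁿ`. -/
abbrev ContIrr (G : Type*) [Group G] [TopologicalSpace G] (n : ℕ) : Type _ :=
  {ρ : Representation ℂ G (Fin n → ℂ) // ρ.IsIrreducible ∧ ∀ x, Continuous fun g => ρ g x}

/-- Twist-equivalence: `ρ ≅ χ ⊗ σ` for a continuous one-dimensional representation `χ`. -/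
def twistSetoid (G : Type*) [Group G] [TopologicalSpace G] (n : ℕ) : Setoid (ContIrr G n) where
  r ρ σ := ∃ χ : G →* ℂˣ, Continuous χ ∧ ∃ e : (Fin n → ℂ) ≃ₗ[ℂ] (Fin n → ℂ),
    ∀ g x, e (ρ.1 g x) = (χ g : ℂ) • σ.1 g (e x)
  iseqv :=
    { refl := fun ρ => ⟨1, continuous_const, .refl ℂ _, fun g x => by simp⟩
      symm := by
        rintro ρ σ ⟨χ, hχ, e, he⟩
        refine ⟨χ⁻¹, hχ.inv, e.symm, fun g x => ?_⟩
        apply e.injective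
        rw [map_smul, he, smul_smul]
        simp
      trans := by
        rintro ρ σ τ ⟨χ, hχ, e, he⟩ ⟨ψ, hψ, f, hf⟩
        refine ⟨χ * ψ, hχ.mul hψ, e.trans f, fun g x => ?_⟩
        simp [he, hf, mul_smul] }

/-- The twist-isoclasses of `n`-dimensional continuous irreducible representations of `G`. -/
abbrev TwistClasses (G : Type*) [Group G] [TopologicalSpace G] (n : ℕ) : Type _ :=
  Quotient (twistSetoid G n)

/-- The number of `n`-dimensional twist-isoclasses. -/
def twistCount (G : Type*) [Group G] [TopologicalSpace G] (n : ℕ) : ℕ :=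
  Nat.card (TwistClasses G n)

/-- The twist representation zeta function of `G`. -/
def twistZeta (G : Type*) [Group G] [TopologicalSpace G] (s : ℂ) : ℂ :=
  LSeries (fun n => (twistCount G n : ℂ)) s

/-! ### Local factors at a nonzero prime of the ring of integers of a number field -/

section Local

variable (K : Type*) [Field K] [NumberField K] (v : IsDedekindDomain.HeightOneSpectrum (𝓞 K))

/-- The completion `𝔬` of `𝓞 K` at the prime `𝔭` given by `v`. -/
abbrev LocalRing : Type _ := v.adicCompletionIntegers K

/-- The residue field cardinality `q = |𝓞 K : 𝔭|`. -/
def residueCard : ℕ := Nat.card (𝓞 K ⧸ v.asIdeal)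

/-- The congruence quotient `H_N = H(𝔬 / 𝔭^N)`. -/
abbrev HeisenbergMod (N : ℕ) : Type _ :=
  Heisenberg (LocalRing K v ⧸ IsLocalRing.maximalIdeal (LocalRing K v) ^ N)

/-- The `N`-th term `ζ^irr_{H_N}(s₁) |𝔬 : 𝔭|^{-N s₂}`. -/
def irrTerm (s₁ s₂ : ℂ) (N : ℕ) : ℂ :=
  zetaIrr (HeisenbergMod K v N) s₁ * (residueCard K v : ℂ) ^ (-(N : ℂ) * s₂)

/-- The `N`-th term `ζ^cc_{H_N}(s₁) |𝔬 : 𝔭|^{-N s₂}`. -/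
def ccTerm (s₁ s₂ : ℂ) (N : ℕ) : ℂ :=
  zetaCC (HeisenbergMod K v N) s₁ * (residueCard K v : ℂ) ^ (-(N : ℂ) * s₂)

/-- The `N`-th term `k(H_N) |𝔬 : 𝔭|^{-N s}`. -/
def classTerm (s : ℂ) (N : ℕ) : ℂ :=
  (classNumber (HeisenbergMod K v N) : ℂ) * (residueCard K v : ℂ) ^ (-(N : ℂ) * s)

/-- The bivariate representation zeta function of `H(𝔬)`. -/
def bivariateIrr (s₁ s₂ : ℂ) : ℂ := ∑' N, irrTerm K v s₁ s₂ N

/-- The bivariate conjugacy class zeta function of `H(𝔬)`. -/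
def bivariateCC (s₁ s₂ : ℂ) : ℂ := ∑' N, ccTerm K v s₁ s₂ N

/-- The class number zeta function of `H(𝔬)`. -/
def classZeta (s : ℂ) : ℂ := ∑' N, classTerm K v s N

end Local

/-! ### Rational functions and their values -/

/-- The field `ℚ(X_0, …, X_{n-1})`. -/
abbrev RatFun (n : ℕ) : Type := FractionRing (MvPolynomial (Fin n) ℚ)

/-- The `i`-th variable in `ℚ(X_0, …, X_{n-1})`. -/
def var {n : ℕ} (i : Fin n) : RatFun n := algebraMap (MvPolynomial (Fin n) ℚ) (RatFun n) (.X i)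

/-- The rational function `W` is defined at the point `a` (with coordinates in an extension field
of `ℚ`) and substituting `a` for the variables gives `z`. -/
def HasValueAt {n : ℕ} {F : Type*} [Field F] [Algebra ℚ F] (W : RatFun n) (a : Fin n → F)
    (z : F) : Prop :=
  ∃ P Q : MvPolynomial (Fin n) ℚ, MvPolynomial.aeval a Q ≠ 0 ∧
    W = algebraMap _ (RatFun n) P / algebraMap _ (RatFun n) Q ∧
    z = MvPolynomial.aeval a P / MvPolynomial.aeval a Q

/-- `(1 - Y₁Y₂) / ((1 - X Y₁Y₂)(1 - X² Y₂))`, where `X, Y₁, Y₂` are the variables `0, 1, 2`. -/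
def ratIrr : RatFun 3 :=
  (1 - var 1 * var 2) / ((1 - var 0 * var 1 * var 2) * (1 - var 0 ^ 2 * var 2))

/-- `(1 - Y₁Y₂) / ((1 - X Y₂)(1 - X² Y₁Y₂))`, where `X, Y₁, Y₂` are the variables `0, 1, 2`. -/
def ratCC : RatFun 3 :=
  (1 - var 1 * var 2) / ((1 - var 0 * var 2) * (1 - var 0 ^ 2 * var 1 * var 2))

/-- `(1 - Y) / ((1 - X Y)(1 - X² Y))`, where `X, Y` are the variables `0, 1`. -/
def ratClass : RatFun 2 :=
  (1 - var 1) / ((1 - var 0 * var 1) * (1 - var 0 ^ 2 * var 1))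

end

end HeisenbergZeta

open HeisenbergZeta

/-! Write `mk a b c` for the matrix with superdiagonal `(a, b)` and corner `c`. Two elements commute
up to the central factor with corner `a * b' - a' * b`. On a finite-dimensional irreducible
representation the centre acts through an additive character `ψ` by Schur's lemma, so all
commutators act by scalars depending only on `ψ`. Hence two such representations with the same `ψ`
differ by a one-dimensional twist (`exists_twisted_equiv`). If `R ⧸ rad ψ` is finite, where `rad ψ`
is the largest ideal in the kernel of `ψ`, the Schrödinger representation on functions on `R ⧸ rad
ψ` realises `ψ`. The dimension attached to `ψ` is then the index of `rad ψ`.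

For finite `R` there are `|R| ^ 2` twisting characters, namely those of `R × R`. Twisting by `α`
leaves the Schrödinger representation unchanged up to isomorphism exactly when `α` is a shift `(a,
b) ↦ ψ (u a + v b)`, and these shifts are parametrised by `(R ⧸ rad ψ) ^ 2`. This gives
`irrCount_mul_sq`: `r_n n² = #{ψ : |R ⧸ rad ψ| = n} |R|²`. Dually, the class of `mk a b c` is
obtained by letting `c` run through a coset of the ideal `(a, b)`, which gives
`ccCount_heisenberg_mul_self`: `c_n n = #{(a, b) : |(a, b)| = n} |R|`.

Over `𝔬 / 𝔭^N` the ideals form a chain with indices `q ^ i`, so both counts are differences of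
consecutive powers, recorded by `powDiff`: of `q` for characters, of `q ^ 2` for pairs. The zeta
function of `H_N` thus has the shape `∑ i ≤ N, powDiff A i * B ^ (N - i) * U ^ i`, with `(A, B) =
(q, q²)` for representations and `(q², q)` for classes. Summing over `N` is a Cauchy product with a
geometric series, and `hasSum_cauchy` gives the closed forms.

Over `𝔬` itself the same character count applies with no upper bound on `i`. Since `ℂˣ` has no small
subgroups, a character of `𝔬` is continuous exactly when its radical has finite index, so the twist
zeta function is the `powDiff` series alone. The limit formula results from cancelling the polar
factor `1 - q ^ (2 - s₂)`. The class number zeta function is the conjugacy class function at `s₁ =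
0`; its agreement with the representation side is read off from the closed forms. The functional
equations are identities of rational functions. -/

namespace HeisenbergZeta

noncomputable section

/-! ### Coordinates on the Heisenberg group -/

namespace Heisenberg

variable {R : Type*} [CommRing R]

/-- The unitriangular matrix with entries `a = g₀₁`, `b = g₁₂`, `c = g₀₂`. -/
def mk (a b c : R) : Heisenberg R :=
  ⟨⟨!![1, a, c; 0, 1, b; 0, 0, 1], by simp [Matrix.det_fin_three]⟩, by
    refine ⟨fun i => ?_, fun i j h => ?_⟩
    · fin_cases i <;> simp
    · fin_cases i <;> fin_cases j <;> simp_all⟩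

/-- The `(i, j)` entry of an element of the Heisenberg group. -/
def entry (i j : Fin 3) (g : Heisenberg R) : R := (g : Matrix.SpecialLinearGroup (Fin 3) R) i j

@[simp] lemma entry_mk_a (a b c : R) : entry 0 1 (mk a b c) = a := rfl
@[simp] lemma entry_mk_b (a b c : R) : entry 1 2 (mk a b c) = b := rfl
@[simp] lemma entry_mk_c (a b c : R) : entry 0 2 (mk a b c) = c := rfl

lemma eq_mk (g : Heisenberg R) : g = mk (entry 0 1 g) (entry 1 2 g) (entry 0 2 g) := by
  obtain ⟨⟨A, hA⟩, h1, h2⟩ := g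
  have a10 := h2 1 0 (by decide)
  have a20 := h2 2 0 (by decide)
  have a21 := h2 2 1 (by decide)
  have a0 := h1 0
  have a1 := h1 1
  have a2 := h1 2
  apply Subtype.ext
  apply Subtype.ext
  ext i j
  fin_cases i <;> fin_cases j <;> simp_all [mk, entry]

lemma mk_mul_mk (a b c a' b' c' : R) :
    mk a b c * mk a' b' c' = mk (a + a') (b + b') (c + c' + a * b') := by
  apply Subtype.ext
  apply Subtype.ext
  ext i j
  change ((!![1, a, c; 0, 1, b; 0, 0, 1] : Matrix (Fin 3) (Fin 3) R) *
    !![1, a', c'; 0, 1, b'; 0, 0, 1]) i j = (!![1, a + a', c + c' + a * b'; 0, 1, b + b'; 0, 0, 1] :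
      Matrix (Fin 3) (Fin 3) R) i j
  fin_cases i <;> fin_cases j <;> simp [Matrix.mul_apply, Fin.sum_univ_three] <;> ring

lemma mk_zero : mk (0 : R) 0 0 = 1 := by
  apply Subtype.ext
  apply Subtype.ext
  ext i j
  fin_cases i <;> fin_cases j <;> simp [mk]

lemma mk_inj {a b c a' b' c' : R} :
    mk a b c = mk a' b' c' ↔ a = a' ∧ b = b' ∧ c = c' := by
  refine ⟨fun h => ⟨congrArg (entry 0 1) h, congrArg (entry 1 2) h, congrArg (entry 0 2) h⟩, ?_⟩
  rintro ⟨rfl, rfl, rfl⟩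
  rfl

@[simp] lemma entry_a_mul (g h : Heisenberg R) : entry 0 1 (g * h) = entry 0 1 g + entry 0 1 h := by
  rw [eq_mk g, eq_mk h, mk_mul_mk]; simp

@[simp] lemma entry_b_mul (g h : Heisenberg R) : entry 1 2 (g * h) = entry 1 2 g + entry 1 2 h := by
  rw [eq_mk g, eq_mk h, mk_mul_mk]; simp

@[simp] lemma entry_c_mul (g h : Heisenberg R) :
    entry 0 2 (g * h) = entry 0 2 g + entry 0 2 h + entry 0 1 g * entry 1 2 h := by
  rw [eq_mk g, eq_mk h, mk_mul_mk]; simp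

@[simp] lemma entry_one {i j : Fin 3} (h : i ≠ j) : entry i j (1 : Heisenberg R) = 0 := by
  simp [entry, h]

/-- The Heisenberg group in coordinates. -/
def equiv : Heisenberg R ≃ (R × R) × R where
  toFun g := ((entry 0 1 g, entry 1 2 g), entry 0 2 g)
  invFun p := mk p.1.1 p.1.2 p.2
  left_inv g := (eq_mk g).symm
  right_inv _ := rfl

/-- Two elements commute up to a central factor. -/
lemma mul_eq_mul_mul_central (g h : Heisenberg R) :
    g * h = h * g * mk 0 0 (entry 0 1 g * entry 1 2 h - entry 0 1 h * entry 1 2 g) := by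
  rw [eq_mk g, eq_mk h]
  simp only [mk_mul_mk, mk_inj, entry_mk_a, entry_mk_b]
  refine ⟨?_, ?_, ?_⟩ <;> ring

lemma mk_eq_mul_central (a b c : R) : mk a b c = mk a b 0 * mk 0 0 c := by
  simp [mk_mul_mk]

lemma central_comm (c : R) (g : Heisenberg R) : mk 0 0 c * g = g * mk 0 0 c := by
  rw [eq_mk g]
  simp only [mk_mul_mk, mk_inj]
  refine ⟨?_, ?_, ?_⟩ <;> ring

lemma continuous_entry [TopologicalSpace R] (i j : Fin 3) :
    Continuous (entry i j : Heisenberg R → R) :=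
  (_root_.continuous_apply j).comp
    (Matrix.SpecialLinearGroup.continuous_apply _ continuous_subtype_val i)

lemma continuous_mk [TopologicalSpace R] {X : Type*} [TopologicalSpace X] {a b c : X → R}
    (ha : Continuous a) (hb : Continuous b) (hc : Continuous c) :
    Continuous fun x => mk (a x) (b x) (c x) := by
  refine Continuous.subtype_mk (Continuous.subtype_mk ?_ _) _
  refine continuous_matrix fun i j => ?_
  fin_cases i <;> fin_cases j <;> simp <;> first | assumption | exact continuous_const

end Heisenberg

/-! ### Generalities on irreducible representations -/

section General

variable {G V W : Type*} [Group G] [AddCommGroup V] [Module ℂ V] [AddCommGroup W] [Module ℂ W]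

/-- Phrasing irreducibility through invariant submodules lets kernels, ranges and eigenspaces be
used directly. -/
lemma isIrreducible_iff (ρ : Representation ℂ G V) :
    ρ.IsIrreducible ↔ Nontrivial V ∧ ∀ U : Submodule ℂ V, (∀ g, ∀ x ∈ U, ρ g x ∈ U) →
      U = ⊥ ∨ U = ⊤ := by
  constructor
  · intro h
    constructor
    · obtain ⟨U, U', hU⟩ := h.toNontrivial
      by_contra hV
      rw [not_nontrivial_iff_subsingleton] at hV
      exact hU (Subrepresentation.toSubmodule_injective (Subsingleton.elim _ _))
    · intro U hU
      rcases h.eq_bot_or_eq_top (⟨U, hU⟩ : Subrepresentation ρ) with h | h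
      · exact .inl (congrArg Subrepresentation.toSubmodule h)
      · exact .inr (congrArg Subrepresentation.toSubmodule h)
  · rintro ⟨hV, h⟩
    refine { exists_pair_ne := ⟨⊥, ⊤, fun e => ?_⟩, eq_bot_or_eq_top := fun U => ?_ }
    · exact bot_ne_top (α := Submodule ℂ V) (congrArg Subrepresentation.toSubmodule e)
    · rcases h U.toSubmodule U.apply_mem_toSubmodule with h | h
      · exact .inl (Subrepresentation.toSubmodule_injective h)
      · exact .inr (Subrepresentation.toSubmodule_injective h)

/-- A nonzero map between irreducible representations that intertwines them up to scalars is
bijective. -/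
lemma bijective_of_twisted_intertwining {ρ : Representation ℂ G V} {σ : Representation ℂ G W}
    (hρ : ρ.IsIrreducible) (hσ : σ.IsIrreducible) {f : V →ₗ[ℂ] W} (hf : f ≠ 0) (χ : G → ℂˣ)
    (h : ∀ g x, f (ρ g x) = (χ g : ℂ) • σ g (f x)) : Function.Bijective f := by
  rw [isIrreducible_iff] at hρ hσ
  constructor
  · rw [← LinearMap.ker_eq_bot]
    refine (hρ.2 (LinearMap.ker f) fun g x hx => ?_).resolve_right fun h => hf ?_
    · rw [LinearMap.mem_ker] at hx ⊢
      rw [h, hx, map_zero, smul_zero]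
    · rwa [LinearMap.ker_eq_top] at h
  · rw [← LinearMap.range_eq_top]
    refine (hσ.2 (LinearMap.range f) fun g y hy => ?_).resolve_left fun h => hf ?_
    · obtain ⟨x, rfl⟩ := hy
      -- The range is stable under `σ g` because the scalar `χ g` can be divided out on the source
      -- side.
      refine ⟨((χ g)⁻¹ : ℂˣ) • ρ g x, ?_⟩
      rw [Units.smul_def, map_smul, h, smul_smul]
      simp
    · rwa [LinearMap.range_eq_bot] at h

/-- Irreducibility is transported along twisted isomorphisms. -/
lemma isIrreducible_of_twisted_equiv {ρ : Representation ℂ G V} {σ : Representation ℂ G W}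
    (hσ : σ.IsIrreducible) (e : V ≃ₗ[ℂ] W) (χ : G → ℂˣ)
    (h : ∀ g x, e (ρ g x) = (χ g : ℂ) • σ g (e x)) : ρ.IsIrreducible := by
  rw [isIrreducible_iff] at hσ ⊢
  obtain ⟨hW, hσ⟩ := hσ
  refine ⟨e.toEquiv.nontrivial, fun U hU => ?_⟩
  have := hσ (U.map (e : V →ₗ[ℂ] W)) (by
    rintro g _ ⟨x, hx, rfl⟩
    refine ⟨((χ g)⁻¹ : ℂˣ) • ρ g x, U.smul_mem _ (hU g x hx), ?_⟩
    rw [Units.smul_def, map_smul]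
    simp [h, smul_smul])
  simpa using this

/-- Schur's lemma for an operator commuting with an irreducible representation. -/
lemma exists_eq_smul_of_commute [FiniteDimensional ℂ V] {ρ : Representation ℂ G V}
    (hρ : ρ.IsIrreducible) (T : Module.End ℂ V) (hT : ∀ g, T * ρ g = ρ g * T) :
    ∃ c : ℂ, ∀ x, T x = c • x := by
  rw [isIrreducible_iff] at hρ
  obtain ⟨hV, hρ⟩ := hρ
  obtain ⟨c, hc⟩ := Module.End.exists_eigenvalue T
  refine ⟨c, fun x => ?_⟩
  have := (hρ (Module.End.eigenspace T c) fun g x hx => ?_).resolve_left hc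
  · exact Module.End.mem_eigenspace_iff.mp (this ▸ Submodule.mem_top)
  · rw [Module.End.mem_eigenspace_iff] at hx ⊢
    change (T * ρ g) x = _
    rw [hT, Module.End.mul_apply, hx, map_smul]

/-- A commuting family of operators on a nonzero finite-dimensional complex space has a common
eigenvector. -/
lemma exists_common_eigenvector {ι : Type*} (n : ℕ) :
    ∀ (V : Type _) [AddCommGroup V] [Module ℂ V] [FiniteDimensional ℂ V] [Nontrivial V]
      (T : ι → Module.End ℂ V), (∀ i j, T i * T j = T j * T i) → Module.finrank ℂ V = n →
      ∃ x ≠ 0, ∃ c : ι → ℂ, ∀ i, T i x = c i • x := by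
  induction n using Nat.strong_induction_on with
  | _ n ih =>
  intro V _ _ _ _ T hT hn
  by_cases hs : ∀ i, ∃ c : ℂ, ∀ x, T i x = c • x
  · choose c hc using hs
    obtain ⟨x, hx⟩ := exists_ne (0 : V)
    exact ⟨x, hx, c, fun i => hc i x⟩
  · push Not at hs
    obtain ⟨i, hi⟩ := hs
    obtain ⟨c, hc⟩ := Module.End.exists_eigenvalue (T i)
    -- A non-scalar member of the family has a proper nonzero eigenspace, stable under all the
    -- others by commutativity; induction on dimension applies to it.
    set U := Module.End.eigenspace (T i) c with hU
    have hUT : U ≠ ⊤ := by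
      intro h
      obtain ⟨x, hx⟩ := hi c
      exact hx (Module.End.mem_eigenspace_iff.mp (h ▸ Submodule.mem_top : x ∈ U))
    have hmaps : ∀ j, ∀ x ∈ U, T j x ∈ U := by
      intro j x hx
      rw [hU, Module.End.mem_eigenspace_iff] at hx ⊢
      change (T i * T j) x = _
      rw [hT, Module.End.mul_apply, hx, map_smul]
    have : Nontrivial U := Submodule.nontrivial_iff_ne_bot.mpr hc
    obtain ⟨x, hx, d, hd⟩ := ih (Module.finrank ℂ U) (hn ▸ Submodule.finrank_lt hUT)
      U (fun j => (T j).restrict (hmaps j))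
      (fun j k => by
        ext x
        exact LinearMap.congr_fun (hT j k) x.1) rfl
    exact ⟨x, by simpa using hx, d, fun j => congrArg Subtype.val (hd j)⟩

/-- Two irreducible representations that agree on commutators up to simultaneous scalars are
twists of each other. -/
lemma exists_twisted_equiv [FiniteDimensional ℂ V] [FiniteDimensional ℂ W]
    {ρ : Representation ℂ G V} {σ : Representation ℂ G W}
    (hρ : ρ.IsIrreducible) (hσ : σ.IsIrreducible)
    (h : ∀ g h : G, ∃ z : G, ∃ c : ℂˣ, g * h = h * g * z ∧ (∀ x, ρ z x = (c : ℂ) • x) ∧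
      ∀ x, σ z x = (c : ℂ) • x) :
    ∃ (χ : G →* ℂˣ) (e : V ≃ₗ[ℂ] W), ∀ g x, e (ρ g x) = (χ g : ℂ) • σ g (e x) := by
  have hV := ((isIrreducible_iff ρ).mp hρ).1
  have hW := ((isIrreducible_iff σ).mp hσ).1
  have hself : ∀ g y, σ g (σ g⁻¹ y) = y := fun g y => by
    rw [← Module.End.mul_apply, ← map_mul]; simp
  have hself' : ∀ g y, ρ g (ρ g⁻¹ y) = y := fun g y => by
    rw [← Module.End.mul_apply, ← map_mul]; simp
  -- `G` acts on `Hom(V, W)` by `f ↦ σ(g)⁻¹ f ρ(g)`. A common eigenvector of these operators is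
  -- precisely an intertwiner up to scalars, and the eigenvalues form the twisting character.
  let T : G → Module.End ℂ (V →ₗ[ℂ] W) := fun g =>
    (LinearMap.llcomp ℂ V W W (σ g⁻¹)) ∘ₗ (LinearMap.lcomp ℂ W (ρ g))
  have hT : ∀ g f x, T g f x = σ g⁻¹ (f (ρ g x)) := fun g f x => rfl
  -- The commutator `z` contributes `c` through `ρ` and `c⁻¹` through `σ`, and these cancel.
  have hcomm : ∀ g k, T g * T k = T k * T g := by
    intro g k
    obtain ⟨z, c, hz, h1, h2⟩ := h k g
    ext f x
    have hz' : ∀ y, σ z⁻¹ y = ((c⁻¹ : ℂˣ) : ℂ) • y := by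
      intro y
      have := hself z y
      rw [h2] at this
      rw [Units.val_inv_eq_inv_val, eq_inv_smul_iff₀ c.ne_zero, this]
    rw [Module.End.mul_apply, Module.End.mul_apply, hT, hT, hT, hT]
    simp only [← Module.End.mul_apply, ← map_mul, ← mul_inv_rev]
    rw [hz]
    simp only [mul_inv_rev, map_mul, Module.End.mul_apply, h1, map_smul, hz', smul_smul]
    simp
  obtain ⟨f, hf, c, hc⟩ := exists_common_eigenvector _ (V →ₗ[ℂ] W) T hcomm rfl
  have hmul : ∀ g x, f (ρ g x) = c g • σ g (f x) := by
    intro g x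
    have := LinearMap.congr_fun (hc g) x
    rw [hT] at this
    rw [← hself g (f (ρ g x)), this]
    simp
  obtain ⟨x, hx⟩ : ∃ x, f x ≠ 0 := by
    by_contra! h
    exact hf (LinearMap.ext h)
  have hne : ∀ g, c g ≠ 0 := by
    intro g h0
    have := hmul g (ρ g⁻¹ x)
    rw [hself', h0, zero_smul] at this
    exact hx this
  have hc1 : c 1 = 1 := by
    have := hmul 1 x
    simp only [map_one, Module.End.one_apply] at this
    exact smul_left_injective ℂ hx (by simpa using this.symm)
  have hcm : ∀ g k, c (g * k) = c g * c k := by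
    intro g k
    have h1 := hmul (g * k) x
    rw [map_mul, Module.End.mul_apply, hmul, hmul, map_smul, smul_smul, map_mul,
      Module.End.mul_apply] at h1
    have hne0 : σ g (σ k (f x)) ≠ 0 := by
      intro h0
      apply hx
      rw [← Module.End.mul_apply, ← map_mul] at h0
      have := congrArg (σ (g * k)⁻¹) h0
      rwa [← Module.End.mul_apply, ← map_mul, inv_mul_cancel, map_one, Module.End.one_apply,
        map_zero] at this
    exact smul_left_injective ℂ hne0 h1.symm
  let χ : G →* ℂˣ :=
    { toFun := fun g => Units.mk0 (c g) (hne g)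
      map_one' := Units.ext hc1
      map_mul' := fun g k => Units.ext (hcm g k) }
  exact ⟨χ, LinearEquiv.ofBijective f (bijective_of_twisted_intertwining hρ hσ hf χ hmul), hmul⟩

/-- The twisting character is continuous when the representations are. -/
lemma continuous_of_twisted_equiv [TopologicalSpace G] [ContinuousInv G] {ι κ : Type*} [Finite ι]
    [Finite κ] [Nonempty κ] {ρ : Representation ℂ G (ι → ℂ)} {σ : Representation ℂ G (κ → ℂ)}
    (hρ : ∀ x, Continuous fun g => ρ g x) (hσ : ∀ x, Continuous fun g => σ g x)
    {χ : G →* ℂˣ} (e : (ι → ℂ) ≃ₗ[ℂ] (κ → ℂ))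
    (h : ∀ g x, e (ρ g x) = (χ g : ℂ) • σ g (e x)) : Continuous χ := by
  have he : Continuous e := LinearMap.continuous_of_finiteDimensional (e : (ι → ℂ) →ₗ[ℂ] (κ → ℂ))
  have hval : Continuous fun g => (χ g : ℂ) := by
    obtain ⟨y, hy⟩ := exists_ne (0 : κ → ℂ)
    obtain ⟨x, rfl⟩ := e.surjective y
    rw [continuous_iff_continuousAt]
    intro g₀
    have hne : σ g₀ (e x) ≠ 0 := by
      intro h0
      apply hy
      have := congrArg (σ g₀⁻¹) h0
      rwa [← Module.End.mul_apply, ← map_mul, inv_mul_cancel, map_one, Module.End.one_apply,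
        map_zero] at this
    -- Near `g₀` the character is a quotient of two continuous coordinate functions, the denominator
    -- being a coordinate that does not vanish at `g₀`.
    obtain ⟨i, hi⟩ := Function.ne_iff.mp hne
    have h1 : Continuous fun g => σ g (e x) i := (continuous_apply i).comp (hσ (e x))
    have h2 : Continuous fun g => e (ρ g x) i := (continuous_apply i).comp (he.comp (hρ x))
    refine (h2.continuousAt.div h1.continuousAt hi).congr ?_
    filter_upwards [h1.continuousAt.eventually_ne hi] with g hg
    rw [Pi.zero_apply] at hg
    simp [h, hg]
  rw [Units.continuous_iff]
  refine ⟨hval, ?_⟩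
  have := hval.comp (continuous_inv (G := G))
  refine this.congr fun g => ?_
  simp

end General

/-! ### Irreducible representations of the Heisenberg group -/

section Schroedinger

variable {R : Type*} [CommRing R]

/-- The largest ideal contained in the kernel of an additive character. -/
def rad (ψ : AddChar R ℂ) : Ideal R where
  carrier := {a | ∀ b, ψ (a * b) = 1}
  add_mem' {a a'} h h' b := by rw [add_mul, ψ.map_add_eq_mul, h, h', mul_one]
  zero_mem' b := by simp
  smul_mem' c a h b := by rw [smul_eq_mul, mul_comm c, mul_assoc, h]

lemma mem_rad {ψ : AddChar R ℂ} {a : R} : a ∈ rad ψ ↔ ∀ b, ψ (a * b) = 1 := Iff.rfl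

/-- An ideal already contains all multiples of its elements. Characters whose radical contains `J`
are therefore the characters of `R ⧸ J`, which makes them countable by duality. -/
lemma le_rad_iff {ψ : AddChar R ℂ} {J : Ideal R} : J ≤ rad ψ ↔ ∀ a ∈ J, ψ a = 1 :=
  ⟨fun h a ha => by simpa using h ha 1, fun h a ha b => h _ (J.mul_mem_right b ha)⟩

lemma apply_eq_of_sub_mem_rad {ψ : AddChar R ℂ} {x y : R} (h : x - y ∈ rad ψ) (b : R) :
    ψ (b * x) = ψ (b * y) := by
  have : b * x = b * y + (x - y) * b := by ring
  rw [this, ψ.map_add_eq_mul, h, mul_one]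

/-- The pairing `(b, x) ↦ ψ (b x)`, as a function of `x` modulo the radical. -/
def pairing (ψ : AddChar R ℂ) (b : R) (x : R ⧸ rad ψ) : ℂ := ψ (b * Quotient.out x)

@[simp] lemma pairing_mk (ψ : AddChar R ℂ) (b x : R) :
    pairing ψ b (Ideal.Quotient.mk (rad ψ) x) = ψ (b * x) := by
  refine apply_eq_of_sub_mem_rad ?_ b
  rw [← Ideal.Quotient.eq]
  exact Quotient.out_eq _

/-- A representation on which the centre acts through `ψ`. -/
def HasCentralChar {V : Type*} [AddCommGroup V] [Module ℂ V]
    (ρ : Representation ℂ (Heisenberg R) V) (ψ : AddChar R ℂ) : Prop :=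
  ∀ c x, ρ (Heisenberg.mk 0 0 c) x = ψ c • x

lemma HasCentralChar.unique {V : Type*} [AddCommGroup V] [Module ℂ V] [Nontrivial V]
    {ρ : Representation ℂ (Heisenberg R) V} {ψ φ : AddChar R ℂ} (h : HasCentralChar ρ ψ)
    (h' : HasCentralChar ρ φ) : ψ = φ := by
  obtain ⟨x, hx⟩ := exists_ne (0 : V)
  ext c
  exact smul_left_injective ℂ hx ((h c x).symm.trans (h' c x))

/-- Characters of the Heisenberg group are trivial on the centre. -/
lemma character_central (χ : Heisenberg R →* ℂˣ) (c : R) : χ (Heisenberg.mk 0 0 c) = 1 := by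
  -- Every central element is a commutator: `mk 0 0 c` arises from `mk c 0 0` and `mk 0 1 0`.
  have h := congrArg χ (Heisenberg.mul_eq_mul_mul_central (Heisenberg.mk c 0 0)
    (Heisenberg.mk 0 1 0))
  simp only [Heisenberg.entry_mk_a, Heisenberg.entry_mk_b, map_mul, mul_one, mul_zero,
    sub_zero, mul_comm (χ (Heisenberg.mk 0 1 0))] at h
  simpa using h

lemma HasCentralChar.of_twisted_equiv {V W : Type*} [AddCommGroup V] [Module ℂ V]
    [AddCommGroup W] [Module ℂ W] {ρ : Representation ℂ (Heisenberg R) V}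
    {σ : Representation ℂ (Heisenberg R) W} {ψ : AddChar R ℂ} (hσ : HasCentralChar σ ψ)
    (χ : Heisenberg R →* ℂˣ) (e : V ≃ₗ[ℂ] W) (h : ∀ g x, e (ρ g x) = (χ g : ℂ) • σ g (e x)) :
    HasCentralChar ρ ψ := by
  intro c x
  apply e.injective
  rw [h, character_central, hσ]
  simp

/-- An irreducible representation has a central character. -/
lemma exists_hasCentralChar {V : Type*} [AddCommGroup V] [Module ℂ V] [FiniteDimensional ℂ V]
    {ρ : Representation ℂ (Heisenberg R) V} (hρ : ρ.IsIrreducible) :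
    ∃ ψ : AddChar R ℂ, HasCentralChar ρ ψ := by
  have hV := ((isIrreducible_iff ρ).mp hρ).1
  obtain ⟨x, hx⟩ := exists_ne (0 : V)
  have : ∀ c, ∃ d : ℂ, ∀ x, ρ (Heisenberg.mk 0 0 c) x = d • x := fun c =>
    exists_eq_smul_of_commute hρ _ fun g => by
      rw [← map_mul, ← map_mul, Heisenberg.central_comm]
  choose d hd using this
  refine ⟨⟨d, ?_, fun a b => ?_⟩, hd⟩
  · refine smul_left_injective ℂ hx ?_
    simp only [← hd, Heisenberg.mk_zero]
    simp
  · refine smul_left_injective ℂ hx ?_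
    simp only [← hd]
    rw [mul_smul, ← hd b, ← hd a, ← Module.End.mul_apply, ← map_mul, Heisenberg.mk_mul_mk]
    simp

/-- Irreducible representations with the same central character are twists of each other. -/
lemma exists_twisted_equiv_of_hasCentralChar {V W : Type*} [AddCommGroup V] [Module ℂ V]
    [AddCommGroup W] [Module ℂ W] [FiniteDimensional ℂ V] [FiniteDimensional ℂ W]
    {ρ : Representation ℂ (Heisenberg R) V} {σ : Representation ℂ (Heisenberg R) W}
    (hρ : ρ.IsIrreducible) (hσ : σ.IsIrreducible) {ψ : AddChar R ℂ} (h : HasCentralChar ρ ψ)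
    (h' : HasCentralChar σ ψ) :
    ∃ (χ : Heisenberg R →* ℂˣ) (e : V ≃ₗ[ℂ] W), ∀ g x, e (ρ g x) = (χ g : ℂ) • σ g (e x) :=
  exists_twisted_equiv hρ hσ fun g k =>
    ⟨_, Units.mk0 _ (ψ.val_isUnit _).ne_zero, Heisenberg.mul_eq_mul_mul_central g k,
      fun x => h _ x, fun x => h' _ x⟩

/-- The Schrödinger representation with central character `ψ`. -/
def schroedinger (ψ : AddChar R ℂ) : Representation ℂ (Heisenberg R) (R ⧸ rad ψ → ℂ) where
  toFun g :=
    { toFun := fun f x => ψ (Heisenberg.entry 0 2 g) * pairing ψ (Heisenberg.entry 1 2 g) x *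
        f (x + Ideal.Quotient.mk (rad ψ) (Heisenberg.entry 0 1 g))
      map_add' := fun f f' => by ext x; simp [mul_add]
      map_smul' := fun c f => by ext x; simp; ring }
  map_one' := by
    ext f x
    obtain ⟨x, rfl⟩ := Ideal.Quotient.mk_surjective x
    simp
  map_mul' g h := by
    refine LinearMap.ext fun f => funext fun x => ?_
    obtain ⟨x, rfl⟩ := Ideal.Quotient.mk_surjective x
    simp only [LinearMap.coe_mk, AddHom.coe_mk, Module.End.mul_apply, ← map_add, pairing_mk,
      Heisenberg.entry_a_mul, Heisenberg.entry_b_mul, Heisenberg.entry_c_mul]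
    rw [add_assoc x, add_mul, mul_add (Heisenberg.entry 1 2 h)]
    simp only [ψ.map_add_eq_mul, mul_comm (Heisenberg.entry 0 1 g)]
    ring

lemma schroedinger_apply (ψ : AddChar R ℂ) (g : Heisenberg R) (f : R ⧸ rad ψ → ℂ) (x : R ⧸ rad ψ) :
    schroedinger ψ g f x = ψ (Heisenberg.entry 0 2 g) * pairing ψ (Heisenberg.entry 1 2 g) x *
        f (x + Ideal.Quotient.mk (rad ψ) (Heisenberg.entry 0 1 g)) := rfl

lemma schroedinger_mk_apply_mk (ψ : AddChar R ℂ) (a b c x : R) (f : R ⧸ rad ψ → ℂ) :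
    schroedinger ψ (Heisenberg.mk a b c) f (Ideal.Quotient.mk _ x) =
      ψ c * ψ (b * x) * f (Ideal.Quotient.mk _ (x + a)) := by
  rw [schroedinger_apply, pairing_mk, map_add]
  rfl

lemma schroedinger_hasCentralChar (ψ : AddChar R ℂ) : HasCentralChar (schroedinger ψ) ψ := by
  intro c f
  ext x
  obtain ⟨x, rfl⟩ := Ideal.Quotient.mk_surjective x
  simp [schroedinger_mk_apply_mk]

lemma schroedinger_of_mem_rad {ψ : AddChar R ℂ} {a b : R} (ha : a ∈ rad ψ) (hb : b ∈ rad ψ)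
    (f : R ⧸ rad ψ → ℂ) : schroedinger ψ (Heisenberg.mk a b 0) f = f := by
  ext x
  obtain ⟨x, rfl⟩ := Ideal.Quotient.mk_surjective x
  rw [schroedinger_mk_apply_mk, hb, map_add, Ideal.Quotient.eq_zero_iff_mem.mpr ha]
  simp

/-- The pairing is a character of the quotient in its first argument. -/
def pairingChar (ψ : AddChar R ℂ) (x : R) : AddChar (R ⧸ rad ψ) ℂ where
  toFun b := pairing ψ x b
  map_zero_eq_one' := by
    rw [← map_zero (Ideal.Quotient.mk (rad ψ)), pairing_mk]
    simp
  map_add_eq_mul' a b := by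
    obtain ⟨a, rfl⟩ := Ideal.Quotient.mk_surjective a
    obtain ⟨b, rfl⟩ := Ideal.Quotient.mk_surjective b
    rw [← map_add, pairing_mk, pairing_mk, pairing_mk, mul_add, ψ.map_add_eq_mul]

@[simp] lemma pairingChar_mk (ψ : AddChar R ℂ) (x b : R) :
    pairingChar ψ x (Ideal.Quotient.mk _ b) = ψ (x * b) := pairing_mk ψ x b

/-- Nondegeneracy of the pairing modulo the radical; `0` denotes the trivial character.
Orthogonality of characters then detects equality of points of `R ⧸ rad ψ`. -/
lemma pairingChar_eq_zero_iff {ψ : AddChar R ℂ} {x : R} : pairingChar ψ x = 0 ↔ x ∈ rad ψ := by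
  rw [AddChar.eq_zero_iff, mem_rad]
  refine ⟨fun h b => by simpa using h (Ideal.Quotient.mk _ b), fun h b => ?_⟩
  obtain ⟨b, rfl⟩ := Ideal.Quotient.mk_surjective b
  simpa using h b

-- Fourier inversion: the operators `mk 0 b 0` multiply by characters that separate points, so a
-- suitable combination of them cuts a nonzero invariant function down to a multiple of a delta
-- function. The translations `mk a 0 0` then produce all delta functions, which span.
open Classical in
lemma schroedinger_isIrreducible (ψ : AddChar R ℂ) [Finite (R ⧸ rad ψ)] :
    (schroedinger ψ).IsIrreducible := by
  have := Fintype.ofFinite (R ⧸ rad ψ)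
  rw [isIrreducible_iff]
  refine ⟨inferInstance, fun U hU => ?_⟩
  rw [or_iff_not_imp_left]
  intro hne
  obtain ⟨f, hf, hf0⟩ := Submodule.exists_mem_ne_zero_of_ne_bot hne
  obtain ⟨x, hx⟩ := Function.ne_iff.mp hf0
  obtain ⟨x, rfl⟩ := Ideal.Quotient.mk_surjective x
  have key : ∑ b : R ⧸ rad ψ, ψ (-(Quotient.out b * x)) •
      schroedinger ψ (Heisenberg.mk 0 (Quotient.out b) 0) f =
      ((Fintype.card (R ⧸ rad ψ) : ℂ) * f (Ideal.Quotient.mk _ x)) •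
        Pi.single (Ideal.Quotient.mk (rad ψ) x) (1 : ℂ) := by
    ext y
    obtain ⟨y, rfl⟩ := Ideal.Quotient.mk_surjective y
    simp only [Finset.sum_apply, Pi.smul_apply, schroedinger_mk_apply_mk, smul_eq_mul, add_zero,
      AddChar.map_zero_eq_one, one_mul]
    have : ∀ b : R ⧸ rad ψ, ψ (-(Quotient.out b * x)) * (ψ (Quotient.out b * y) *
        f (Ideal.Quotient.mk _ y)) = pairingChar ψ (y - x) b * f (Ideal.Quotient.mk _ y) := by
      intro b
      change _ = ψ ((y - x) * Quotient.out b) * _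
      rw [← mul_assoc, ← ψ.map_add_eq_mul]
      congr 2
      ring
    rw [Finset.sum_congr rfl fun b _ => this b, ← Finset.sum_mul, AddChar.sum_eq_ite]
    by_cases hxy : Ideal.Quotient.mk (rad ψ) y = Ideal.Quotient.mk (rad ψ) x
    · rw [if_pos (pairingChar_eq_zero_iff.mpr (Ideal.Quotient.eq.mp hxy)), hxy]
      simp
    · rw [if_neg (fun h => hxy (Ideal.Quotient.eq.mpr (pairingChar_eq_zero_iff.mp h))),
        Pi.single_eq_of_ne hxy]
      simp
  have hx1 : Pi.single (Ideal.Quotient.mk (rad ψ) x) (1 : ℂ) ∈ U := by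
    have h1 : ((Fintype.card (R ⧸ rad ψ) : ℂ) * f (Ideal.Quotient.mk _ x)) ≠ 0 :=
      mul_ne_zero (Nat.cast_ne_zero.mpr Fintype.card_ne_zero) hx
    rw [← U.smul_mem_iff h1, ← key]
    exact U.sum_mem fun b _ => U.smul_mem _ (hU _ _ hf)
  have hall : ∀ y : R ⧸ rad ψ, Pi.single y (1 : ℂ) ∈ U := by
    intro y
    obtain ⟨y, rfl⟩ := Ideal.Quotient.mk_surjective y
    -- Evaluating the delta function at `x` on `z + (x - y)` gives the delta function at `y`.
    convert hU (Heisenberg.mk (x - y) 0 0) _ hx1 using 1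
    ext z
    obtain ⟨z, rfl⟩ := Ideal.Quotient.mk_surjective z
    rw [schroedinger_mk_apply_mk]
    simp only [AddChar.map_zero_eq_one, zero_mul, one_mul, Pi.single_apply]
    congr 1
    rw [Ideal.Quotient.eq, Ideal.Quotient.eq]
    congr! 1
    ring
  rw [eq_top_iff]
  rintro f -
  rw [pi_eq_sum_univ' f]
  refine U.sum_mem fun y _ => U.smul_mem _ ?_
  convert hall y using 1

/-- Twists of the Schrödinger representation on a standard vector space. -/
lemma exists_twisted_schroedinger (ψ : AddChar R ℂ) {n : ℕ} (hn : n ≠ 0)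
    (hψ : Nat.card (R ⧸ rad ψ) = n) (χ : Heisenberg R →* ℂˣ) :
    ∃ (ρ : Representation ℂ (Heisenberg R) (Fin n → ℂ))
      (e : (Fin n → ℂ) ≃ₗ[ℂ] (R ⧸ rad ψ → ℂ)), ρ.IsIrreducible ∧
      ∀ g x, e (ρ g x) = (χ g : ℂ) • schroedinger ψ g (e x) := by
  have hfin : Finite (R ⧸ rad ψ) := Nat.finite_of_card_ne_zero (hψ ▸ hn)
  let e : (Fin n → ℂ) ≃ₗ[ℂ] (R ⧸ rad ψ → ℂ) :=
    LinearEquiv.funCongrLeft ℂ ℂ (Finite.equivFinOfCardEq hψ)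
  let ρ : Representation ℂ (Heisenberg R) (Fin n → ℂ) :=
    { toFun := fun g => (χ g : ℂ) • e.symm.conj (schroedinger ψ g)
      map_one' := by ext; simp
      map_mul' := fun g h => by
        refine LinearMap.ext fun x => ?_
        simpa [LinearEquiv.conj_apply, mul_smul] using smul_comm _ _ _ }
  have h : ∀ g x, e (ρ g x) = (χ g : ℂ) • schroedinger ψ g (e x) := by
    intro g x
    simp [ρ, LinearEquiv.conj_apply]
  exact ⟨ρ, e, isIrreducible_of_twisted_equiv (schroedinger_isIrreducible ψ) e χ h, h⟩

end Schroedinger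

/-! ### Counting twist-isoclasses -/

section Twist

variable {R : Type*} [CommRing R] [TopologicalSpace R]

lemma HasCentralChar.continuous {n : ℕ} [NeZero n]
    {ρ : Representation ℂ (Heisenberg R) (Fin n → ℂ)} (hc : ∀ x, Continuous fun g => ρ g x)
    {ψ : AddChar R ℂ} (h : HasCentralChar ρ ψ) : Continuous ψ := by
  have h1 := (hc 1).comp
    (Heisenberg.continuous_mk (continuous_const (y := (0 : R))) (continuous_const (y := (0 : R)))
      continuous_id)
  refine ((continuous_apply (0 : Fin n)).comp h1).congr fun c => ?_
  simp [h c]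

variable [IsTopologicalRing R]

/-- With an open radical, every function on `R ⧸ rad ψ` pulls back to a locally constant function on
`R`, so each coordinate is continuous in `g`. -/
lemma continuous_schroedinger {ψ : AddChar R ℂ} (hψ : Continuous ψ)
    (ho : IsOpen (rad ψ : Set R)) (f : R ⧸ rad ψ → ℂ) : Continuous fun g => schroedinger ψ g f := by
  refine continuous_pi fun x => ?_
  obtain ⟨x, rfl⟩ := Ideal.Quotient.mk_surjective x
  simp only [schroedinger_apply, pairing_mk, ← map_add]
  refine Continuous.mul ((hψ.comp (Heisenberg.continuous_entry 0 2)).mul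
    (hψ.comp ((Heisenberg.continuous_entry 1 2).mul continuous_const))) ?_
  have hf : IsLocallyConstant fun y : R => f (Ideal.Quotient.mk (rad ψ) y) := by
    refine (IsLocallyConstant.iff_exists_open _).mpr fun y => ?_
    refine ⟨(fun z => z - y) ⁻¹' rad ψ, ho.preimage (by fun_prop), by simp, fun z hz => ?_⟩
    rw [Ideal.Quotient.eq.mpr hz]
  exact hf.continuous.comp (continuous_const.add (Heisenberg.continuous_entry 0 1))

/-- Twist-isoclasses of continuous irreducible representations of the Heisenberg group are
classified by the central character. -/
lemma nonempty_equiv_twistClasses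
    (hR : ∀ ψ : AddChar R ℂ, Continuous ψ → IsOpen (rad ψ : Set R) ∧ Finite (R ⧸ rad ψ))
    {n : ℕ} (hn : n ≠ 0) :
    Nonempty ({ψ : AddChar R ℂ // Continuous ψ ∧ Nat.card (R ⧸ rad ψ) = n} ≃
      TwistClasses (Heisenberg R) n) := by
  have : NeZero n := ⟨hn⟩
  choose ρ e hρ he using fun ψ : {ψ : AddChar R ℂ // Continuous ψ ∧ Nat.card (R ⧸ rad ψ) = n} =>
    exists_twisted_schroedinger ψ.1 hn ψ.2.2 1
  have hcont : ∀ ψ x, Continuous fun g => ρ ψ g x := by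
    intro ψ x
    have hfin := (hR ψ.1 ψ.2.1).2
    have h1 : Continuous (e ψ).symm :=
      LinearMap.continuous_of_finiteDimensional ((e ψ).symm : (R ⧸ rad ψ.1 → ℂ) →ₗ[ℂ] (Fin n → ℂ))
    refine (h1.comp (continuous_schroedinger ψ.2.1 (hR ψ.1 ψ.2.1).1 (e ψ x))).congr fun g => ?_
    simp [LinearEquiv.symm_apply_eq, he]
  have hchar : ∀ ψ, HasCentralChar (ρ ψ) ψ.1 := fun ψ =>
    (schroedinger_hasCentralChar ψ.1).of_twisted_equiv 1 (e ψ) (he ψ)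
  refine ⟨Equiv.ofBijective
    (fun ψ => Quotient.mk (twistSetoid (Heisenberg R) n) ⟨ρ ψ, hρ ψ, hcont ψ⟩) ⟨?_, ?_⟩⟩
  · intro ψ φ h
    obtain ⟨χ, -, f, hf⟩ := Quotient.exact h
    exact Subtype.ext ((hchar ψ).unique ((hchar φ).of_twisted_equiv χ f hf))
  · intro σ
    induction σ using Quotient.inductionOn with
    | _ σ =>
    obtain ⟨σ, hσ, hσc⟩ := σ
    obtain ⟨ψ, hψ⟩ := exists_hasCentralChar hσ
    have hψc := hψ.continuous hσc
    have hfin := (hR ψ hψc).2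
    -- This first comparison serves only to identify the dimension `n` with the index of the
    -- radical; the twist by `χ` is found below against the chosen representative.
    obtain ⟨χ, f, hf⟩ := exists_twisted_equiv_of_hasCentralChar hσ (schroedinger_isIrreducible ψ)
      hψ (schroedinger_hasCentralChar ψ)
    have hcard : Nat.card (R ⧸ rad ψ) = n := by
      have := f.finrank_eq
      have hft := Fintype.ofFinite (R ⧸ rad ψ)
      simpa [Nat.card_eq_fintype_card] using this.symm
    refine ⟨⟨ψ, hψc, hcard⟩, Quotient.sound ?_⟩
    obtain ⟨χ, f, hf⟩ := exists_twisted_equiv_of_hasCentralChar (hρ ⟨ψ, hψc, hcard⟩) hσ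
      (hchar ⟨ψ, hψc, hcard⟩) hψ
    exact ⟨χ, continuous_of_twisted_equiv (hcont _) hσc f hf, f, hf⟩

end Twist

/-! ### Counting irreducible representations over finite rings -/

section Finite

variable {R : Type*} [CommRing R]

/-- A character of the abelianisation `R × R`, as a character of the Heisenberg group. -/
def liftChar (α : AddChar (R × R) ℂ) : Heisenberg R →* ℂˣ :=
  MonoidHom.toHomUnits
    { toFun := fun g => α (Heisenberg.entry 0 1 g, Heisenberg.entry 1 2 g)
      map_one' := by
        rw [Heisenberg.entry_one (by decide), Heisenberg.entry_one (by decide)]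
        exact α.map_zero_eq_one
      map_mul' := fun g h => by
        rw [Heisenberg.entry_a_mul, Heisenberg.entry_b_mul, ← α.map_add_eq_mul]
        rfl }

@[simp] lemma liftChar_apply (α : AddChar (R × R) ℂ) (g : Heisenberg R) :
    (liftChar α g : ℂ) = α (Heisenberg.entry 0 1 g, Heisenberg.entry 1 2 g) := rfl

/-- The corner entry is the only coordinate that does not multiply additively, and characters ignore
it. -/
lemma exists_eq_liftChar (χ : Heisenberg R →* ℂˣ) : ∃ α, χ = liftChar α := by
  have key : ∀ a b c, χ (Heisenberg.mk a b c) = χ (Heisenberg.mk a b 0) := fun a b c => by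
    rw [Heisenberg.mk_eq_mul_central, map_mul, character_central, mul_one]
  refine ⟨⟨fun p => χ (Heisenberg.mk p.1 p.2 0), ?_, fun p r => ?_⟩, ?_⟩
  · simp [Heisenberg.mk_zero]
  · rw [← Units.val_mul, ← map_mul, Heisenberg.mk_mul_mk, key _ _ (_ + _)]
    rfl
  · ext g
    conv_lhs => rw [Heisenberg.eq_mk g, key]
    rfl

/-- The character `(a, b) ↦ ψ (u a + v b)`. -/
def shiftChar (ψ : AddChar R ℂ) (u v : R) : AddChar (R × R) ℂ where
  toFun p := ψ (u * p.1 + v * p.2)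
  map_zero_eq_one' := by simp
  map_add_eq_mul' p r := by
    rw [← ψ.map_add_eq_mul]
    congr 1
    simp only [Prod.fst_add, Prod.snd_add]
    ring

@[simp] lemma shiftChar_apply (ψ : AddChar R ℂ) (u v : R) (p : R × R) :
    shiftChar ψ u v p = ψ (u * p.1 + v * p.2) := rfl

/-- Additive characters trivial on an ideal are characters of the quotient. -/
def addCharQuotientEquiv (J : Ideal R) :
    AddChar (R ⧸ J) ℂ ≃ {α : AddChar R ℂ // ∀ a ∈ J, α a = 1} where
  toFun β := ⟨β.compAddMonoidHom (Ideal.Quotient.mk J : R →+ R ⧸ J), fun a ha => by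
    simp [Ideal.Quotient.eq_zero_iff_mem.mpr ha]⟩
  invFun α :=
    { toFun := fun x => α.1 (Quotient.out x)
      map_zero_eq_one' := α.2 _ (Ideal.Quotient.eq_zero_iff_mem.mp (Quotient.out_eq _))
      map_add_eq_mul' := fun x y => by
        rw [← α.1.map_add_eq_mul, ← div_eq_one_iff_eq (α.1.val_isUnit _).ne_zero,
          ← AddChar.map_sub_eq_div]
        refine α.2 _ (Ideal.Quotient.eq.mp ?_)
        rw [map_add]
        have h : ∀ z : R ⧸ J, Ideal.Quotient.mk J (Quotient.out z) = z := Quotient.out_eq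
        rw [h, h, h] }
  left_inv β := by
    ext x
    exact congrArg β (Quotient.out_eq x)
  right_inv α := by
    ext x
    change α.1 (Quotient.out (Ideal.Quotient.mk J x)) = α.1 x
    rw [← div_eq_one_iff_eq (α.1.val_isUnit _).ne_zero, ← AddChar.map_sub_eq_div]
    exact α.2 _ (Ideal.Quotient.eq.mp (Quotient.out_eq _))

lemma card_addChar_trivial_on (J : Ideal R) [Finite (R ⧸ J)] :
    Nat.card {α : AddChar R ℂ // ∀ a ∈ J, α a = 1} = Nat.card (R ⧸ J) := by
  have := Fintype.ofFinite (R ⧸ J)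
  rw [← Nat.card_congr (addCharQuotientEquiv J), Nat.card_eq_fintype_card,
    Nat.card_eq_fintype_card]
  exact AddChar.card_eq

/-- Additive characters trivial on the radical of `ψ` are shifts of `ψ`. -/
lemma exists_shift_of_trivial_on_rad {ψ : AddChar R ℂ} [Finite (R ⧸ rad ψ)] {α : AddChar R ℂ}
    (hα : ∀ a ∈ rad ψ, α a = 1) : ∃ u, ∀ a, α a = ψ (u * a) := by
  have hJ := card_addChar_trivial_on (rad ψ)
  have : Finite {α : AddChar R ℂ // ∀ a ∈ rad ψ, α a = 1} :=
    Nat.finite_of_card_ne_zero (hJ ▸ Nat.card_pos.ne')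
  let F : R ⧸ rad ψ → {α : AddChar R ℂ // ∀ a ∈ rad ψ, α a = 1} := fun x =>
    ⟨ψ.mulShift (Quotient.out x), fun a ha => by rw [AddChar.mulShift_apply, mul_comm, ha]⟩
  -- Shifts of `ψ` by distinct residues modulo the radical are distinct, and there are as many
  -- residues as characters of `R ⧸ rad ψ`; injectivity therefore forces surjectivity.
  have hF : Function.Injective F := by
    intro x y h
    rw [← Quotient.out_eq x, ← Quotient.out_eq y]
    refine Ideal.Quotient.eq.mpr fun b => ?_
    have := DFunLike.congr_fun (congrArg Subtype.val h) b
    simp only [F, AddChar.mulShift_apply] at this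
    rw [sub_mul, AddChar.map_sub_eq_div, this, div_self (ψ.val_isUnit _).ne_zero]
  have hb := (Nat.bijective_iff_injective_and_card F).mpr ⟨hF, hJ.symm⟩
  obtain ⟨x, hx⟩ := hb.2 ⟨α, hα⟩
  exact ⟨Quotient.out x, fun a =>
    (DFunLike.congr_fun (congrArg Subtype.val hx) a).symm⟩

lemma exists_shiftChar_of_trivial {ψ : AddChar R ℂ} [Finite (R ⧸ rad ψ)] {α : AddChar (R × R) ℂ}
    (hα : ∀ a ∈ rad ψ, ∀ b ∈ rad ψ, α (a, b) = 1) : ∃ u v, α = shiftChar ψ u v := by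
  obtain ⟨u, hu⟩ := exists_shift_of_trivial_on_rad (ψ := ψ)
    (α := α.compAddMonoidHom (AddMonoidHom.inl R R)) fun a ha => hα a ha 0 (zero_mem _)
  obtain ⟨v, hv⟩ := exists_shift_of_trivial_on_rad (ψ := ψ)
    (α := α.compAddMonoidHom (AddMonoidHom.inr R R)) fun a ha => hα 0 (zero_mem _) a ha
  refine ⟨u, v, ?_⟩
  ext p
  rw [shiftChar_apply, ψ.map_add_eq_mul, ← hu, ← hv, AddChar.compAddMonoidHom_apply,
    AddChar.compAddMonoidHom_apply, ← α.map_add_eq_mul]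
  simp

lemma shiftChar_eq_iff {ψ : AddChar R ℂ} {u v u' v' : R} :
    shiftChar ψ u v = shiftChar ψ u' v' ↔ u - u' ∈ rad ψ ∧ v - v' ∈ rad ψ := by
  constructor
  · intro h
    refine ⟨fun b => ?_, fun b => ?_⟩
    · have := DFunLike.congr_fun h (b, 0)
      simp only [shiftChar_apply, mul_zero, add_zero] at this
      rw [sub_mul, AddChar.map_sub_eq_div, this, div_self (ψ.val_isUnit _).ne_zero]
    · have := DFunLike.congr_fun h (0, b)
      simp only [shiftChar_apply, mul_zero, zero_add] at this
      rw [sub_mul, AddChar.map_sub_eq_div, this, div_self (ψ.val_isUnit _).ne_zero]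
  · rintro ⟨h, h'⟩
    ext p
    simp only [shiftChar_apply, ψ.map_add_eq_mul]
    rw [mul_comm u, mul_comm v, mul_comm u', mul_comm v', apply_eq_of_sub_mem_rad h,
      apply_eq_of_sub_mem_rad h']

/-- The Schrödinger representation absorbs twists by shifts of its central character. -/
lemma schroedinger_intertwine (ψ : AddChar R ℂ) (u v : R) (g : Heisenberg R)
    (f : R ⧸ rad ψ → ℂ) :
    schroedinger ψ (Heisenberg.mk v (-u) 0) (schroedinger ψ g f) =
      (liftChar (shiftChar ψ u v) g : ℂ) •
        schroedinger ψ g (schroedinger ψ (Heisenberg.mk v (-u) 0) f) := by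
  rw [← Module.End.mul_apply, ← map_mul, Heisenberg.mul_eq_mul_mul_central, map_mul,
    Module.End.mul_apply, schroedinger_hasCentralChar, map_smul, map_mul, Module.End.mul_apply]
  congr 1
  rw [liftChar_apply, shiftChar_apply]
  congr 1
  simp only [Heisenberg.entry_mk_a, Heisenberg.entry_mk_b]
  ring

end Finite

section FiniteCount

variable {R : Type*} [CommRing R]

lemma card_eq_card_mul_of_fibers {α β : Type*} [Finite α] {f : α → β}
    (hf : Function.Surjective f) {k : ℕ} (hk : ∀ b, Nat.card {a // f a = b} = k) :
    Nat.card α = Nat.card β * k := by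
  have := Finite.of_surjective f hf
  have := Fintype.ofFinite β
  rw [← Nat.card_congr (Equiv.sigmaFiberEquiv f), Nat.card_sigma]
  simp [hk]

/-- On a twist of the Schrödinger representation by `α`, the element `mk a b 0` with `a, b` in the
radical acts as the scalar `α (a, b)`. -/
lemma twisted_schroedinger_of_mem_rad {ψ : AddChar R ℂ} {V : Type*} [AddCommGroup V] [Module ℂ V]
    {ρ : Representation ℂ (Heisenberg R) V} {e : V ≃ₗ[ℂ] (R ⧸ rad ψ → ℂ)} {α : AddChar (R × R) ℂ}
    (he : ∀ g x, e (ρ g x) = (liftChar α g : ℂ) • schroedinger ψ g (e x)) {a b : R}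
    (ha : a ∈ rad ψ) (hb : b ∈ rad ψ) (x : V) : ρ (Heisenberg.mk a b 0) x = α (a, b) • x := by
  apply e.injective
  rw [he, schroedinger_of_mem_rad ha hb, map_smul]
  rfl

instance finite_addChar {A : Type*} [AddCommGroup A] [Finite A] : Finite (AddChar A ℂ) := by
  have := Fintype.ofFinite A
  exact Finite.of_fintype _

/-- The number of irreducible representations of the Heisenberg group over a finite ring in terms
of the radicals of the additive characters. -/
lemma irrCount_mul_sq [Finite R] {n : ℕ} (hn : n ≠ 0) :
    irrCount (Heisenberg R) n * n ^ 2 =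
      Nat.card {ψ : AddChar R ℂ // Nat.card (R ⧸ rad ψ) = n} * Nat.card R ^ 2 := by
  have : NeZero n := ⟨hn⟩
  have hq : ∀ ψ : AddChar R ℂ, Finite (R ⧸ rad ψ) := fun ψ =>
    Finite.of_surjective _ Ideal.Quotient.mk_surjective
  choose ρ e hρ he using fun p : {ψ : AddChar R ℂ // Nat.card (R ⧸ rad ψ) = n} ×
    AddChar (R × R) ℂ => exists_twisted_schroedinger p.1.1 hn p.1.2 (liftChar p.2)
  have hchar : ∀ p, HasCentralChar (ρ p) p.1.1 := fun p =>
    (schroedinger_hasCentralChar p.1.1).of_twisted_equiv _ (e p) (he p)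
  let F := fun p => Quotient.mk (irrSetoid (Heisenberg R) n) ⟨ρ p, hρ p⟩
  have hsurj : Function.Surjective F := by
    intro σ
    induction σ using Quotient.inductionOn with
    | _ σ =>
    obtain ⟨σ, hσ⟩ := σ
    obtain ⟨ψ, hψ⟩ := exists_hasCentralChar hσ
    obtain ⟨χ, f, hf⟩ := exists_twisted_equiv_of_hasCentralChar hσ (schroedinger_isIrreducible ψ)
      hψ (schroedinger_hasCentralChar ψ)
    obtain ⟨α, rfl⟩ := exists_eq_liftChar χ
    have hcard : Nat.card (R ⧸ rad ψ) = n := by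
      have := f.finrank_eq
      have hft := Fintype.ofFinite (R ⧸ rad ψ)
      simpa [Nat.card_eq_fintype_card] using this.symm
    refine ⟨(⟨ψ, hcard⟩, α), Quotient.sound ⟨.mk ((e (⟨ψ, hcard⟩, α)).trans f.symm) fun g => ?_⟩⟩
    refine LinearMap.ext fun x => ?_
    apply f.injective
    simp [he, hf]
  -- The fibres of `F` are the orbits of the shift characters, which gives every fibre `n ^ 2`
  -- elements.
  have hfib : ∀ p q, F p = F q ↔ p.1 = q.1 ∧ ∃ u v, q.2 = p.2 * shiftChar p.1.1 u v := by
    rintro ⟨ψ, α⟩ ⟨φ, β⟩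
    constructor
    · intro h
      obtain ⟨E⟩ := Quotient.exact h
      have hE : ∀ g x, E (ρ (ψ, α) g x) = ρ (φ, β) g (E x) := fun g x =>
        Representation.IntertwiningMap.isIntertwining _ _ E.toIntertwiningMap g x
      have hψφ : ψ = φ := by
        refine Subtype.ext ((hchar (ψ, α)).unique ((hchar (φ, β)).of_twisted_equiv 1
          E.toLinearEquiv fun g x => ?_))
        simpa using hE g x
      subst hψφ
      refine ⟨rfl, ?_⟩
      -- On elements with both coordinates in the radical the two representations act by the scalars
      -- `α` and `β`. An isomorphism makes these agree, so `α⁻¹ * β` is trivial there.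
      obtain ⟨u, v, huv⟩ := exists_shiftChar_of_trivial (ψ := ψ.1) (α := α⁻¹ * β)
        fun a ha b hb => by
          obtain ⟨x, hx⟩ := exists_ne (0 : Fin n → ℂ)
          have h1 := hE (Heisenberg.mk a b 0) x
          rw [twisted_schroedinger_of_mem_rad (he (ψ, α)) ha hb,
            twisted_schroedinger_of_mem_rad (he (ψ, β)) ha hb, map_smul] at h1
          have h2 : α (a, b) = β (a, b) :=
            smul_left_injective ℂ ((map_ne_zero_iff _ E.toLinearEquiv.injective).mpr hx) h1
          rw [AddChar.mul_apply, AddChar.inv_apply', h2,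
            inv_mul_cancel₀ (β.val_isUnit _).ne_zero]
      exact ⟨u, v, by rw [← huv, mul_inv_cancel_left]⟩
    · rintro ⟨h1, u, v, h2⟩
      obtain rfl : ψ = φ := h1
      obtain rfl : β = α * shiftChar ψ.1 u v := h2
      -- The intertwiner is the action of the group element `mk v (-u) 0`: conjugating by it
      -- multiplies by exactly the shift character of `(u, v)`.
      refine Quotient.sound ⟨.mk (((e (ψ, α)).trans (LinearEquiv.ofBijective _
        ((schroedinger ψ.1).apply_bijective (Heisenberg.mk v (-u) 0)))).trans
          (e (ψ, α * shiftChar ψ.1 u v)).symm) fun g => ?_⟩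
      refine LinearMap.ext fun x => ?_
      apply (e (ψ, α * shiftChar ψ.1 u v)).injective
      simp only [LinearMap.comp_apply, LinearEquiv.coe_coe, LinearEquiv.trans_apply,
        LinearEquiv.ofBijective_apply, he, LinearEquiv.apply_symm_apply,
        map_smul, schroedinger_intertwine, smul_smul]
      rfl
  have hmain := card_eq_card_mul_of_fibers hsurj (k := n ^ 2) fun σ => by
    obtain ⟨⟨ψ, α⟩, rfl⟩ := hsurj σ
    have hcard : n ^ 2 = Nat.card ((R ⧸ rad ψ.1) × (R ⧸ rad ψ.1)) := by
      rw [Nat.card_prod, ψ.2, pow_two]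
    rw [hcard]
    symm
    have hfib' : ∀ r : (R ⧸ rad ψ.1) × (R ⧸ rad ψ.1), F (ψ, α * shiftChar ψ.1 (Quotient.out r.1)
        (Quotient.out r.2)) = F (ψ, α) := fun r => Eq.symm <|
      (hfib (ψ, α) (ψ, α * shiftChar ψ.1 (Quotient.out r.1) (Quotient.out r.2))).mpr
        ⟨rfl, Quotient.out r.1, Quotient.out r.2, rfl⟩
    refine Nat.card_congr (Equiv.ofBijective (fun r => ⟨(ψ, α * shiftChar ψ.1 (Quotient.out r.1)
      (Quotient.out r.2)), hfib' r⟩) ⟨?_, ?_⟩)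
    · intro r r' h
      have h1 := congrArg (fun p => p.1.2) h
      simp only [mul_right_inj, shiftChar_eq_iff] at h1
      rw [← Ideal.Quotient.eq, ← Ideal.Quotient.eq] at h1
      have h2 : ∀ z : R ⧸ rad ψ.1, Ideal.Quotient.mk (rad ψ.1) (Quotient.out z) = z :=
        Quotient.out_eq
      rw [h2, h2, h2, h2] at h1
      exact Prod.ext h1.1 h1.2
    · rintro ⟨⟨φ, β⟩, h⟩
      obtain ⟨h1, u, v, h2⟩ := (hfib _ _).mp h.symm
      obtain rfl : ψ = φ := h1
      refine ⟨(Ideal.Quotient.mk _ u, Ideal.Quotient.mk _ v), Subtype.ext (Prod.ext rfl ?_)⟩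
      refine Eq.trans ?_ h2.symm
      simp only [mul_right_inj, shiftChar_eq_iff]
      exact ⟨Ideal.Quotient.eq.mp (Quotient.out_eq _), Ideal.Quotient.eq.mp (Quotient.out_eq _)⟩
  have := Fintype.ofFinite R
  rw [irrCount, ← hmain, Nat.card_prod]
  congr 1
  rw [pow_two, ← Nat.card_prod, Nat.card_eq_fintype_card, Nat.card_eq_fintype_card,
    AddChar.card_eq]

/-! ### Conjugacy classes -/

/-- Conjugation by `h` fixes `a` and `b` and adds `h₀₁ b - a h₁₂` to `c`. As `h` varies, these
increments fill the ideal generated by `a` and `b`. -/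
lemma card_carrier_mk [Finite R] (a b c : R) :
    Nat.card (ConjClasses.mk (Heisenberg.mk a b c)).carrier = Nat.card (Ideal.span {a, b}) := by
  have key : ∀ g, g ∈ (ConjClasses.mk (Heisenberg.mk a b c)).carrier ↔
      ∃ t ∈ Ideal.span {a, b}, g = Heisenberg.mk a b (c + t) := by
    intro g
    rw [ConjClasses.mem_carrier_iff_mk_eq, ConjClasses.mk_eq_mk_iff_isConj, isConj_comm,
      isConj_iff]
    constructor
    · rintro ⟨h, rfl⟩
      refine ⟨Heisenberg.entry 0 1 h * b - a * Heisenberg.entry 1 2 h, ?_, ?_⟩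
      · refine Ideal.mem_span_pair.mpr ⟨-Heisenberg.entry 1 2 h, Heisenberg.entry 0 1 h, ?_⟩
        ring
      · rw [mul_inv_eq_iff_eq_mul, Heisenberg.eq_mk h]
        simp only [Heisenberg.mk_mul_mk, Heisenberg.mk_inj, Heisenberg.entry_mk_a,
          Heisenberg.entry_mk_b]
        refine ⟨?_, ?_, ?_⟩ <;> ring
    · rintro ⟨t, ht, rfl⟩
      obtain ⟨x, y, rfl⟩ := Ideal.mem_span_pair.mp ht
      refine ⟨Heisenberg.mk y (-x) 0, ?_⟩
      rw [mul_inv_eq_iff_eq_mul]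
      simp only [Heisenberg.mk_mul_mk, Heisenberg.mk_inj]
      refine ⟨?_, ?_, ?_⟩ <;> ring
  symm
  refine Nat.card_congr (Equiv.ofBijective (fun t => ⟨Heisenberg.mk a b (c + t.1),
    (key _).mpr ⟨t.1, t.2, rfl⟩⟩) ⟨fun t t' h => ?_, ?_⟩)
  · have := (Heisenberg.mk_inj.mp (congrArg Subtype.val h)).2.2
    exact Subtype.ext (add_left_cancel this)
  · rintro ⟨g, hg⟩
    obtain ⟨t, ht, rfl⟩ := (key g).mp hg
    exact ⟨⟨t, ht⟩, rfl⟩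

instance [Finite R] : Finite (Heisenberg R) := Finite.of_equiv _ Heisenberg.equiv.symm

/-- The number of elements with conjugacy class of size `n`. -/
lemma ccCount_mul_self {G : Type*} [Group G] [Finite G] (n : ℕ) :
    ccCount G n * n = Nat.card {g : G // Nat.card (ConjClasses.mk g).carrier = n} := by
  symm
  refine card_eq_card_mul_of_fibers
    (f := fun g => (⟨ConjClasses.mk g.1, g.2⟩ : {C : ConjClasses G // Nat.card C.carrier = n}))
    ?_ ?_
  · rintro ⟨C, hC⟩
    induction C using Quotient.inductionOn with
    | _ g => exact ⟨⟨g, hC⟩, rfl⟩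
  · rintro ⟨C, hC⟩
    conv_rhs => rw [← hC]
    refine Nat.card_congr
      { toFun := fun g => ⟨g.1.1, ConjClasses.mem_carrier_iff_mk_eq.mpr (congrArg Subtype.val g.2)⟩
        invFun := fun g => ⟨⟨g.1, by rw [ConjClasses.mem_carrier_iff_mk_eq.mp g.2, hC]⟩,
          Subtype.ext (ConjClasses.mem_carrier_iff_mk_eq.mp g.2)⟩
        left_inv := fun _ => rfl
        right_inv := fun _ => rfl }

lemma ccCount_heisenberg_mul_self [Finite R] (n : ℕ) :
    ccCount (Heisenberg R) n * n =
      Nat.card {p : R × R // Nat.card (Ideal.span {p.1, p.2}) = n} * Nat.card R := by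
  rw [ccCount_mul_self, ← Nat.card_prod]
  refine Nat.card_congr (Equiv.trans (Equiv.subtypeEquiv
    (q := fun p : (R × R) × R => Nat.card (Ideal.span {p.1.1, p.1.2}) = n)
      Heisenberg.equiv fun g => ?_) ?_)
  · conv_lhs => rw [Heisenberg.eq_mk g, card_carrier_mk]
    rfl
  · exact
      { toFun := fun p => (⟨p.1.1, p.2⟩, p.1.2)
        invFun := fun p => ⟨(p.1.1, p.2), p.1.2⟩
        left_inv := fun _ => rfl
        right_inv := fun _ => rfl }

/-- At `s = 0` the conjugacy class zeta function counts all conjugacy classes. -/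
lemma zetaCC_zero (G : Type*) [Group G] [Finite G] : zetaCC G 0 = classNumber G := by
  have := Fintype.ofFinite (ConjClasses G)
  have hpos : ∀ C : ConjClasses G, Nat.card C.carrier ≠ 0 := by
    intro C
    induction C using Quotient.inductionOn with
    | _ g =>
      have : Nonempty (ConjClasses.carrier (Quotient.mk _ g)) := ⟨⟨g, ConjClasses.mem_carrier_mk⟩⟩
      exact Nat.card_pos.ne'
  have hle : ∀ C : ConjClasses G, Nat.card C.carrier ∈ Finset.range (Nat.card G + 1) := fun C =>
    Finset.mem_range_succ_iff.mpr (Finite.card_subtype_le _)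
  -- The term of an `LSeries` at index `0` is `0` by convention; this is harmless since no conjugacy
  -- class is empty.
  have h1 : ∀ n, (ccCount G n : ℂ) = LSeries.term (fun n => (ccCount G n : ℂ)) 0 n := by
    intro n
    rcases eq_or_ne n 0 with rfl | hn
    · have : IsEmpty {C : ConjClasses G // Nat.card C.carrier = 0} := ⟨fun C => hpos C.1 C.2⟩
      rw [ccCount, Nat.card_of_isEmpty]
      simp
    · simp [LSeries.term_of_ne_zero hn]
  classical
  have h2 : ∀ n, ccCount G n = (Finset.univ.filter fun C : ConjClasses G =>
      Nat.card C.carrier = n).card := by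
    intro n
    rw [ccCount, Nat.card_eq_fintype_card, Fintype.card_subtype]
  rw [zetaCC, LSeries, ← funext h1, tsum_eq_sum (s := Finset.range (Nat.card G + 1)), classNumber,
    Nat.card_eq_fintype_card (α := ConjClasses G), ← Finset.card_univ (α := ConjClasses G),
    Finset.card_eq_sum_card_fiberwise (f := fun C => Nat.card C.carrier)
      (t := Finset.range (Nat.card G + 1)) fun C _ => hle C]
  · rw [Nat.cast_sum]
    exact Finset.sum_congr rfl fun n _ => by rw [h2]
  · intro n hn
    rw [h2, Nat.cast_eq_zero, Finset.card_eq_zero, Finset.filter_eq_empty_iff]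
    rintro C - rfl
    exact hn (hle C)

end FiniteCount

/-! ### Rings whose ideals of finite index form a chain -/

/-- The ideals of finite index of `R` are `J 0 ≥ J 1 ≥ ⋯`, up to `J N`, and `J i` has
index `q ^ i`. -/
structure FiniteIndexChain (R : Type*) [CommRing R] (q : ℕ) (N : ℕ∞) (J : ℕ → Ideal R) :
    Prop where
  anti : Antitone J
  card_quot : ∀ i : ℕ, (i : ℕ∞) ≤ N → Nat.card (R ⧸ J i) = q ^ i
  exists_eq : ∀ I : Ideal R, Finite (R ⧸ I) → ∃ i : ℕ, (i : ℕ∞) ≤ N ∧ I = J i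

lemma card_quot_le_of_le {R : Type*} [CommRing R] {I J : Ideal R} (h : I ≤ J) [Finite (R ⧸ I)] :
    Nat.card (R ⧸ J) ≤ Nat.card (R ⧸ I) :=
  Nat.card_le_card_of_surjective _ (Ideal.Quotient.factor_surjective h)

lemma finite_quot_of_le {R : Type*} [CommRing R] {I J : Ideal R} (h : I ≤ J) [Finite (R ⧸ I)] :
    Finite (R ⧸ J) :=
  Finite.of_surjective _ (Ideal.Quotient.factor_surjective h)

namespace FiniteIndexChain

variable {R : Type*} [CommRing R] {q : ℕ} {N : ℕ∞} {J : ℕ → Ideal R}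

lemma finite_quot (h : FiniteIndexChain R q N J) (hq : 1 < q) {i : ℕ} (hi : (i : ℕ∞) ≤ N) :
    Finite (R ⧸ J i) :=
  Nat.finite_of_card_ne_zero (by rw [h.card_quot i hi]; positivity)

lemma le_iff (h : FiniteIndexChain R q N J) (hq : 1 < q) {i k : ℕ} (hi : (i : ℕ∞) ≤ N)
    (hk : (k : ℕ∞) ≤ N) : J i ≤ J k ↔ k ≤ i := by
  refine ⟨fun hle => ?_, fun hle => h.anti hle⟩
  have := h.finite_quot hq hi
  have := card_quot_le_of_le hle
  rwa [h.card_quot i hi, h.card_quot k hk, Nat.pow_le_pow_iff_right hq] at this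

lemma ncard_le_rad (h : FiniteIndexChain R q N J) (hq : 1 < q) {i : ℕ} (hi : (i : ℕ∞) ≤ N) :
    {ψ : AddChar R ℂ | J i ≤ rad ψ}.ncard = q ^ i := by
  have := h.finite_quot hq hi
  rw [← h.card_quot i hi, ← card_addChar_trivial_on, ← Nat.card_coe_set_eq]
  exact Nat.card_congr (Equiv.subtypeEquivRight fun ψ => le_rad_iff)

lemma card_quot_rad_eq_iff (h : FiniteIndexChain R q N J) (hq : 1 < q) {i : ℕ}
    (hi : (i : ℕ∞) ≤ N) (I : Ideal R) : Nat.card (R ⧸ I) = q ^ i ↔ I = J i := by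
  refine ⟨fun hI => ?_, fun hI => hI ▸ h.card_quot i hi⟩
  have : Finite (R ⧸ I) := Nat.finite_of_card_ne_zero (by rw [hI]; positivity)
  obtain ⟨k, hk, rfl⟩ := h.exists_eq I this
  rw [h.card_quot k hk] at hI
  rw [Nat.pow_right_injective hq hI]

lemma exists_card_quot_eq_pow (h : FiniteIndexChain R q N J) {I : Ideal R}
    (hI : Nat.card (R ⧸ I) ≠ 0) : ∃ i : ℕ, (i : ℕ∞) ≤ N ∧ Nat.card (R ⧸ I) = q ^ i := by
  obtain ⟨k, hk, rfl⟩ := h.exists_eq I (Nat.finite_of_card_ne_zero hI)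
  exact ⟨k, hk, h.card_quot k hk⟩

/-- The number of characters whose radical has index one. -/
lemma card_rad_zero (h : FiniteIndexChain R q N J) (hq : 1 < q) :
    Nat.card {ψ : AddChar R ℂ // Nat.card (R ⧸ rad ψ) = q ^ 0} = 1 := by
  have hN : ((0 : ℕ) : ℕ∞) ≤ N := by simp
  refine Eq.trans ?_ ((h.ncard_le_rad hq hN).trans (pow_zero q))
  rw [← Nat.card_coe_set_eq]
  refine Nat.card_congr (Equiv.subtypeEquivRight fun ψ => ?_)
  rw [Set.mem_ofPred_eq, h.card_quot_rad_eq_iff hq hN]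
  refine ⟨fun hψ => hψ.ge, fun hψ => ?_⟩
  have := h.finite_quot hq hN
  obtain ⟨k, hk, hk'⟩ := h.exists_eq _ (finite_quot_of_le hψ)
  rw [hk'] at hψ ⊢
  rw [Nat.le_zero.mp ((h.le_iff hq hN hk).mp hψ)]

/-- The number of characters whose radical has index `q ^ (i + 1)`. -/
lemma card_rad_succ (h : FiniteIndexChain R q N J) (hq : 1 < q) {i : ℕ}
    (hi : ((i + 1 : ℕ) : ℕ∞) ≤ N) :
    Nat.card {ψ : AddChar R ℂ // Nat.card (R ⧸ rad ψ) = q ^ (i + 1)} + q ^ i = q ^ (i + 1) := by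
  have hi' : (i : ℕ∞) ≤ N := le_trans (by exact_mod_cast Nat.le_succ i) hi
  have hsub : {ψ : AddChar R ℂ | J i ≤ rad ψ} ⊆ {ψ | J (i + 1) ≤ rad ψ} :=
    fun ψ hψ => (h.anti (Nat.le_succ i)).trans hψ
  have hfin : {ψ : AddChar R ℂ | J (i + 1) ≤ rad ψ}.Finite :=
    Set.finite_of_ncard_ne_zero (by rw [h.ncard_le_rad hq hi]; positivity)
  -- In the chain, an ideal containing `J (i + 1)` but not `J i` must be `J (i + 1)` itself.
  have := Set.ncard_sdiff_add_ncard_of_subset hsub hfin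
  rw [h.ncard_le_rad hq hi, h.ncard_le_rad hq hi'] at this
  refine Eq.trans ?_ this
  rw [← Nat.card_coe_set_eq]
  congr 1
  refine Nat.card_congr (Equiv.subtypeEquivRight fun ψ => ?_)
  rw [h.card_quot_rad_eq_iff hq hi, Set.mem_sdiff, Set.mem_ofPred_eq, Set.mem_ofPred_eq]
  constructor
  · intro hψ
    rw [hψ, h.le_iff hq hi' hi]
    exact ⟨le_rfl, by omega⟩
  · rintro ⟨h1, h2⟩
    have := h.finite_quot hq hi
    obtain ⟨k, hk, hk'⟩ := h.exists_eq _ (finite_quot_of_le h1)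
    rw [hk', h.le_iff hq hi hk] at h1
    rw [hk', h.le_iff hq hi' hk] at h2
    rw [hk', show k = i + 1 by omega]

/-- `A ^ i - A ^ (i - 1)`, read as `1` for `i = 0`. -/
def powDiff (A : ℂ) : ℕ → ℂ
  | 0 => 1
  | i + 1 => A ^ (i + 1) - A ^ i

lemma card_rad (h : FiniteIndexChain R q N J) (hq : 1 < q) {i : ℕ} (hi : (i : ℕ∞) ≤ N) :
    (Nat.card {ψ : AddChar R ℂ // Nat.card (R ⧸ rad ψ) = q ^ i} : ℂ) = powDiff q i := by
  cases i with
  | zero => rw [h.card_rad_zero hq, powDiff, Nat.cast_one]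
  | succ i =>
    rw [powDiff, eq_sub_iff_add_eq]
    exact_mod_cast h.card_rad_succ hq hi

/-! ### Ideals, pairs and zeta coefficients for finite chain rings -/

section Finite

variable {N : ℕ}

lemma eq_bot (h : FiniteIndexChain R q N J) [Finite R] : J N = ⊥ := by
  obtain ⟨k, hk, hk'⟩ := h.exists_eq ⊥ (Finite.of_surjective _ Ideal.Quotient.mk_surjective)
  rw [eq_bot_iff, hk']
  exact h.anti (by exact_mod_cast hk)

lemma card_eq (h : FiniteIndexChain R q N J) [Finite R] : Nat.card R = q ^ N := by
  rw [← h.card_quot N le_rfl, h.eq_bot]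
  exact Nat.card_congr (RingEquiv.quotientBot R).symm.toEquiv

lemma card_ideal (h : FiniteIndexChain R q N J) (hq : 1 < q) [Finite R] {k : ℕ} (hk : k ≤ N) :
    Nat.card (J k) = q ^ (N - k) := by
  have := Submodule.card_eq_card_quotient_mul_card (J k)
  rw [h.card_eq, h.card_quot k (by exact_mod_cast hk),
    ← pow_sub_mul_pow q hk] at this
  exact (Nat.eq_of_mul_eq_mul_right (by positivity) this).symm

lemma ncard_span_le (h : FiniteIndexChain R q N J) (hq : 1 < q) [Finite R] {k : ℕ} (hk : k ≤ N) :
    {p : R × R | Ideal.span {p.1, p.2} ≤ J k}.ncard = (q ^ 2) ^ (N - k) := by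
  rw [← pow_mul, mul_comm, pow_mul, ← h.card_ideal hq hk, pow_two, ← Nat.card_prod,
    ← Nat.card_coe_set_eq]
  refine Nat.card_congr (Equiv.trans (Equiv.subtypeEquivRight
    (q := fun p : R × R => p.1 ∈ J k ∧ p.2 ∈ J k) fun p => ?_) Equiv.subtypeProdEquivProd)
  rw [Set.mem_ofPred_eq, Ideal.span_le]
  simp [Set.insert_subset_iff]

lemma card_ideal_eq_iff (h : FiniteIndexChain R q N J) (hq : 1 < q) [Finite R] {i : ℕ}
    (hi : i ≤ N) (I : Ideal R) : Nat.card I = q ^ i ↔ I = J (N - i) := by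
  obtain ⟨k, hk, rfl⟩ := h.exists_eq I (Finite.of_surjective _ Ideal.Quotient.mk_surjective)
  have hk' : k ≤ N := by exact_mod_cast hk
  rw [h.card_ideal hq hk']
  constructor
  · intro hI
    rw [← Nat.pow_right_injective hq hI, Nat.sub_sub_self hk']
  · intro hI
    rw [← h.card_ideal hq hk', hI, h.card_ideal hq (Nat.sub_le _ _), Nat.sub_sub_self hi]

lemma exists_card_ideal_eq_pow (h : FiniteIndexChain R q N J) (hq : 1 < q) [Finite R]
    (I : Ideal R) : ∃ i ≤ N, Nat.card I = q ^ i := by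
  obtain ⟨k, hk, rfl⟩ := h.exists_eq I (Finite.of_surjective _ Ideal.Quotient.mk_surjective)
  exact ⟨N - k, Nat.sub_le _ _, h.card_ideal hq (by exact_mod_cast hk)⟩

/-- The ideal of order `q ^ i` is `J (N - i)`. A pair generates it when both entries lie in it but
not both in the next smaller ideal, whence a difference of squares of consecutive ideal orders. -/
lemma card_span (h : FiniteIndexChain R q N J) (hq : 1 < q) [Finite R] {i : ℕ} (hi : i ≤ N) :
    (Nat.card {p : R × R // Nat.card (Ideal.span {p.1, p.2}) = q ^ i} : ℂ) =
      powDiff ((q : ℂ) ^ 2) i := by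
  cases i with
  | zero =>
    rw [powDiff, Nat.cast_eq_one]
    refine Eq.trans ?_ ((h.ncard_span_le hq le_rfl).trans (by simp))
    rw [← Nat.card_coe_set_eq]
    refine Nat.card_congr (Equiv.subtypeEquivRight fun p => ?_)
    rw [Set.mem_ofPred_eq, h.card_ideal_eq_iff hq hi, Nat.sub_zero, h.eq_bot, le_bot_iff]
  | succ i =>
    have hsub : {p : R × R | Ideal.span {p.1, p.2} ≤ J (N - i)} ⊆
        {p | Ideal.span {p.1, p.2} ≤ J (N - (i + 1))} :=
      fun p hp => le_trans hp (h.anti (by omega))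
    have := Set.ncard_sdiff_add_ncard_of_subset hsub
    rw [h.ncard_span_le hq (by omega), h.ncard_span_le hq (by omega), Nat.sub_sub_self hi,
      Nat.sub_sub_self (by omega)] at this
    rw [powDiff, eq_sub_iff_add_eq]
    have h2 : Nat.card {p : R × R // Nat.card (Ideal.span {p.1, p.2}) = q ^ (i + 1)} =
        ({p : R × R | Ideal.span {p.1, p.2} ≤ J (N - (i + 1))} \
          {p | Ideal.span {p.1, p.2} ≤ J (N - i)}).ncard := by
      rw [← Nat.card_coe_set_eq]
      refine Nat.card_congr (Equiv.subtypeEquivRight fun p => ?_)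
      rw [h.card_ideal_eq_iff hq hi, Set.mem_sdiff, Set.mem_ofPred_eq, Set.mem_ofPred_eq]
      obtain ⟨k, hk, hk'⟩ := h.exists_eq (Ideal.span {p.1, p.2})
        (Finite.of_surjective _ Ideal.Quotient.mk_surjective)
      have hcast : ∀ m : ℕ, ((N - m : ℕ) : ℕ∞) ≤ N := fun m => by exact_mod_cast Nat.sub_le N m
      rw [hk', h.le_iff hq hk (hcast _), h.le_iff hq hk (hcast _)]
      have hkN : k ≤ N := by exact_mod_cast hk
      constructor
      · intro hJ
        have h1 := (h.le_iff hq hk (hcast _)).mp hJ.le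
        have h2 := (h.le_iff hq (hcast _) hk).mp hJ.ge
        omega
      · intro hJ
        rw [show k = N - (i + 1) by omega]
    rw [h2]
    exact_mod_cast this

/-- The numbers of irreducible representations of the Heisenberg group. -/
lemma irrCount_pow (h : FiniteIndexChain R q N J) (hq : 1 < q) [Finite R] {i : ℕ} (hi : i ≤ N) :
    (irrCount (Heisenberg R) (q ^ i) : ℂ) = powDiff q i * ((q : ℂ) ^ 2) ^ (N - i) := by
  have hq0 : (q : ℂ) ≠ 0 := Nat.cast_ne_zero.mpr (by omega)
  have h1 := congrArg (Nat.cast (R := ℂ))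
    (irrCount_mul_sq (R := R) (n := q ^ i) (pow_ne_zero _ (by omega)))
  push_cast at h1
  rw [h.card_rad hq (by exact_mod_cast hi), h.card_eq] at h1
  -- Dividing `|R| ^ 2 = q ^ (2 * N)` by the squared dimension `q ^ (2 * i)` leaves `(q ^ 2) ^ (N -
  -- i)`.
  refine mul_right_cancel₀ (b := (((q : ℂ) ^ i) ^ 2)) (by positivity) (h1.trans ?_)
  rw [mul_assoc]
  congr 1
  push_cast
  rw [← pow_mul, ← pow_mul, ← pow_mul, ← pow_add]
  congr 1
  omega

lemma irrCount_eq_zero (h : FiniteIndexChain R q N J) [Finite R] {n : ℕ} (hn : n ≠ 0)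
    (hn' : ∀ i ≤ N, n ≠ q ^ i) : irrCount (Heisenberg R) n = 0 := by
  have h1 := irrCount_mul_sq (R := R) hn
  have : IsEmpty {ψ : AddChar R ℂ // Nat.card (R ⧸ rad ψ) = n} := by
    refine ⟨fun ψ => ?_⟩
    obtain ⟨i, hi, hi'⟩ := h.exists_card_quot_eq_pow (ψ.2.trans_ne hn)
    exact hn' i (by exact_mod_cast hi) (ψ.2.symm.trans hi')
  rw [Nat.card_of_isEmpty, zero_mul] at h1
  exact (mul_eq_zero.mp h1).resolve_right (pow_ne_zero _ hn)

/-- The numbers of conjugacy classes of the Heisenberg group. -/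
lemma ccCount_pow (h : FiniteIndexChain R q N J) (hq : 1 < q) [Finite R] {i : ℕ} (hi : i ≤ N) :
    (ccCount (Heisenberg R) (q ^ i) : ℂ) = powDiff ((q : ℂ) ^ 2) i * (q : ℂ) ^ (N - i) := by
  have hq0 : (q : ℂ) ≠ 0 := Nat.cast_ne_zero.mpr (by omega)
  have h1 := congrArg (Nat.cast (R := ℂ)) (ccCount_heisenberg_mul_self (R := R) (q ^ i))
  push_cast at h1
  rw [h.card_span hq hi, h.card_eq] at h1
  refine mul_right_cancel₀ (b := ((q : ℂ) ^ i)) (by positivity) (h1.trans ?_)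
  rw [mul_assoc, ← pow_add, Nat.sub_add_cancel hi]
  push_cast
  rfl

lemma ccCount_eq_zero (h : FiniteIndexChain R q N J) (hq : 1 < q) [Finite R] {n : ℕ} (hn : n ≠ 0)
    (hn' : ∀ i ≤ N, n ≠ q ^ i) : ccCount (Heisenberg R) n = 0 := by
  have h1 := ccCount_heisenberg_mul_self (R := R) n
  have : IsEmpty {p : R × R // Nat.card (Ideal.span {p.1, p.2}) = n} := by
    refine ⟨fun p => ?_⟩
    obtain ⟨i, hi, hi'⟩ := h.exists_card_ideal_eq_pow hq (Ideal.span {p.1.1, p.1.2})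
    exact hn' i hi (p.2.symm.trans hi')
  rw [Nat.card_of_isEmpty, zero_mul] at h1
  exact (mul_eq_zero.mp h1).resolve_right hn

end Finite

end FiniteIndexChain

/-! ### The completed local ring -/

section Local

open IsDedekindDomain IsDedekindDomain.HeightOneSpectrum IsLocalRing

variable (K : Type*) [Field K] [NumberField K] (v : HeightOneSpectrum (𝓞 K))

lemma one_lt_residueCard : 1 < residueCard K v := by
  have := NumberField.HeightOneSpectrum.one_lt_absNorm v
  rwa [Ideal.absNorm_apply] at this

variable {K v}

lemma mem_maximalIdeal_iff (x : LocalRing K v) :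
    x ∈ maximalIdeal (LocalRing K v) ↔ Valued.v (x : v.adicCompletion K) < 1 :=
  Valuation.mem_maximalIdeal_iff (K := v.adicCompletion K) (v := Valued.v)

lemma algebraMap_mem_maximalIdeal_iff (r : 𝓞 K) :
    algebraMap (𝓞 K) (LocalRing K v) r ∈ maximalIdeal (LocalRing K v) ↔ r ∈ v.asIdeal := by
  rw [mem_maximalIdeal_iff, algebraMap_adicCompletionIntegers_apply,
    valuedAdicCompletion_eq_valuation', valuation_lt_one_iff_mem]

lemma isOpen_valued_lt (z : v.adicCompletion K) :
    IsOpen {y : v.adicCompletion K | Valued.v y < Valued.v z} := by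
  have := Valued.isOpen_ball (v.adicCompletion K) (Valued.v.restrict z)
  simpa only [Valuation.restrict_lt_iff] using this

/-- Every element of the completion is congruent to an algebraic integer. -/
lemma exists_algebraMap_sub_mem (x : LocalRing K v) :
    ∃ r : 𝓞 K, algebraMap (𝓞 K) (LocalRing K v) r - x ∈ maximalIdeal (LocalRing K v) := by
  -- Approximation in two stages: `K` is dense in the completion, and an element of `K` integral at
  -- `v` is congruent to an element of `𝓞 K`.
  obtain ⟨k, hk⟩ : ∃ k : K, Valued.v ((k : v.adicCompletion K) - x) < 1 := by
    have hopen : IsOpen {y : v.adicCompletion K | Valued.v (y - x) < 1} := by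
      have h1 := (isOpen_valued_lt (K := K) (v := v) 1).preimage
        (f := fun y => y - (x : v.adicCompletion K)) (by fun_prop)
      simpa using h1
    obtain ⟨k, hk⟩ := (denseRange_algebraMap (K := K) (v := v)).exists_mem_open hopen ⟨x, by simp⟩
    exact ⟨k, by rwa [algebraMap_adicCompletion] at hk⟩
  have hk1 : v.valuation K k ≤ 1 := by
    rw [← valuedAdicCompletion_eq_valuation']
    have h2 := Valued.v.map_add ((k : v.adicCompletion K) - x) x
    rw [sub_add_cancel] at h2
    exact h2.trans (max_le hk.le x.2)
  obtain ⟨r, hr⟩ := v.exists_valuation_sub_lt_of_integer hk1 1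
  refine ⟨r, (mem_maximalIdeal_iff _).mpr ?_⟩
  have h3 : ((algebraMap (𝓞 K) (LocalRing K v) r - x : LocalRing K v) : v.adicCompletion K) =
      ((algebraMap (𝓞 K) K r - k : K) : v.adicCompletion K) + ((k : v.adicCompletion K) - x) := by
    rw [AddSubgroupClass.coe_sub, algebraMap_adicCompletionIntegers_apply]
    have : ((algebraMap (𝓞 K) K r : K) : v.adicCompletion K) =
        ((algebraMap (𝓞 K) K r - k : K) : v.adicCompletion K) + (k : v.adicCompletion K) := by
      rw [← adicCompletion.coe_add, sub_add_cancel]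
    rw [this]
    ring
  rw [h3]
  refine (Valued.v.map_add _ _).trans_lt (max_lt ?_ hk)
  rw [valuedAdicCompletion_eq_valuation']
  simpa using hr

lemma card_residue : Nat.card (LocalRing K v ⧸ maximalIdeal (LocalRing K v)) =
    residueCard K v := by
  let f : 𝓞 K →+* LocalRing K v ⧸ maximalIdeal (LocalRing K v) :=
    (Ideal.Quotient.mk _).comp (algebraMap _ _)
  have hf : Function.Surjective f := by
    intro x
    obtain ⟨x, rfl⟩ := Ideal.Quotient.mk_surjective x
    obtain ⟨r, hr⟩ := exists_algebraMap_sub_mem x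
    exact ⟨r, Ideal.Quotient.eq.mpr hr⟩
  have hker : RingHom.ker f = v.asIdeal := by
    ext r
    rw [RingHom.mem_ker, ← algebraMap_mem_maximalIdeal_iff]
    exact Ideal.Quotient.eq_zero_iff_mem
  rw [residueCard, ← hker]
  exact Nat.card_congr (RingHom.quotientKerEquivOfSurjective hf).toEquiv.symm

lemma card_quot_pow (i : ℕ) : Nat.card (LocalRing K v ⧸ maximalIdeal (LocalRing K v) ^ i) =
    residueCard K v ^ i := by
  have := cardQuot_pow_of_prime (P := maximalIdeal (LocalRing K v))
    (IsDiscreteValuationRing.not_a_field _) (i := i)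
  rw [Submodule.cardQuot_apply, Submodule.cardQuot_apply, card_residue] at this
  exact this

variable (K v)

/-- In a discrete valuation ring the nonzero ideals are the powers of the maximal ideal; only the
zero ideal has to be excluded, and it has infinite index. The length `⊤` records that the chain does
not stop. -/
lemma finiteIndexChain_localRing :
    FiniteIndexChain (LocalRing K v) (residueCard K v) ⊤
      fun i => maximalIdeal (LocalRing K v) ^ i where
  anti := fun i j hij => Ideal.pow_le_pow_right hij
  card_quot i _ := card_quot_pow i
  exists_eq I hI := by
    obtain ⟨ϖ, hϖ⟩ := IsDiscreteValuationRing.exists_irreducible (LocalRing K v)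
    have hne : I ≠ ⊥ := by
      rintro rfl
      -- If the ring were finite with `n` elements, its quotient by the `n`-th power of the maximal
      -- ideal would have `q ^ n > n` elements.
      have h1 : Nat.card (LocalRing K v ⧸ (⊥ : Ideal (LocalRing K v))) <
          residueCard K v ^ Nat.card (LocalRing K v ⧸ (⊥ : Ideal (LocalRing K v))) :=
        Nat.lt_pow_self (one_lt_residueCard K v)
      rw [← card_quot_pow] at h1
      exact absurd (card_quot_le_of_le bot_le) (not_le.mpr h1)
    obtain ⟨n, hn⟩ := IsDiscreteValuationRing.ideal_eq_span_pow_irreducible hne hϖ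
    refine ⟨n, le_top, ?_⟩
    rw [hn, hϖ.maximalIdeal_eq, Ideal.span_singleton_pow]

lemma finiteIndexChain_quot (N : ℕ) :
    FiniteIndexChain (LocalRing K v ⧸ maximalIdeal (LocalRing K v) ^ N) (residueCard K v) N
      fun i => (maximalIdeal (LocalRing K v) ^ i).map (Ideal.Quotient.mk _) where
  anti := fun i j hij => Ideal.map_mono (Ideal.pow_le_pow_right hij)
  card_quot i hi := by
    have hle : maximalIdeal (LocalRing K v) ^ N ≤ maximalIdeal (LocalRing K v) ^ i :=
      Ideal.pow_le_pow_right (by exact_mod_cast hi)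
    rw [← card_quot_pow]
    exact Nat.card_congr (DoubleQuot.quotQuotEquivQuotOfLE hle).toEquiv
  exists_eq I hI := by
    have hle : maximalIdeal (LocalRing K v) ^ N ≤ I.comap (Ideal.Quotient.mk _) := by
      intro x hx
      rw [Ideal.mem_comap, Ideal.Quotient.eq_zero_iff_mem.mpr hx]
      exact zero_mem I
    have h := finiteIndexChain_localRing K v
    have hq := one_lt_residueCard K v
    have := h.finite_quot hq (i := N) le_top
    obtain ⟨k, -, hk⟩ := h.exists_eq _ (finite_quot_of_le hle)
    refine ⟨k, ?_, ?_⟩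
    · rw [hk] at hle
      exact_mod_cast (h.le_iff hq le_top le_top).mp hle
    · rw [← hk, Ideal.map_comap_of_surjective _ Ideal.Quotient.mk_surjective]

instance (N : ℕ) : Finite (LocalRing K v ⧸ maximalIdeal (LocalRing K v) ^ N) :=
  (finiteIndexChain_localRing K v).finite_quot (one_lt_residueCard K v) le_top

variable {K v}

lemma exists_pow_maximalIdeal_subset {U : Set (LocalRing K v)} (hU : U ∈ nhds 0) :
    ∃ i, ((maximalIdeal (LocalRing K v) ^ i : Ideal (LocalRing K v)) : Set (LocalRing K v)) ⊆ U := by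
  obtain ⟨ϖ, hϖ⟩ := IsDiscreteValuationRing.exists_irreducible (LocalRing K v)
  have hϖ1 : Valued.v (ϖ : v.adicCompletion K) < 1 :=
    (mem_maximalIdeal_iff ϖ).mp (hϖ.maximalIdeal_eq ▸ Ideal.mem_span_singleton_self ϖ)
  rw [nhds_subtype_eq_comap, Filter.mem_comap] at hU
  obtain ⟨V, hV, hVU⟩ := hU
  obtain ⟨γ, hγ⟩ := Valued.mem_nhds_zero.mp hV
  have hγ0 : MonoidWithZeroHom.ValueGroup₀.embedding γ.1 ≠ 0 := by simp
  -- The value group is archimedean, so some power of the uniformiser falls below the radius of the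
  -- given ball.
  obtain ⟨i, hi⟩ := exists_pow_lt₀ hϖ1 (Units.mk0 _ hγ0)
  refine ⟨i, fun x hx => hVU (hγ ?_)⟩
  rw [hϖ.maximalIdeal_eq, Ideal.span_singleton_pow, SetLike.mem_coe,
    Ideal.mem_span_singleton'] at hx
  obtain ⟨y, rfl⟩ := hx
  rw [Set.mem_ofPred_eq, Valuation.restrict_lt_iff_lt_embedding]
  refine lt_of_le_of_lt ?_ hi
  rw [MulMemClass.coe_mul, SubmonoidClass.coe_pow, map_mul, map_pow]
  exact mul_le_of_le_one_left' y.2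

lemma isOpen_pow_maximalIdeal (i : ℕ) :
    IsOpen ((maximalIdeal (LocalRing K v) ^ i : Ideal (LocalRing K v)) : Set (LocalRing K v)) := by
  obtain ⟨ϖ, hϖ⟩ := IsDiscreteValuationRing.exists_irreducible (LocalRing K v)
  refine AddSubgroup.isOpen_of_mem_nhds
    (maximalIdeal (LocalRing K v) ^ i : Ideal (LocalRing K v)).toAddSubgroup (g := 0) ?_
  refine Filter.mem_of_superset (((isOpen_valued_lt ((ϖ : v.adicCompletion K) ^ i)).preimage
    continuous_subtype_val).mem_nhds ?_) ?_
  · have : (ϖ : v.adicCompletion K) ≠ 0 := by simpa using hϖ.ne_zero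
    simp [zero_lt_iff, this]
  · intro x hx
    rw [SetLike.mem_coe, Submodule.mem_toAddSubgroup, hϖ.maximalIdeal_eq, Ideal.span_singleton_pow,
      Ideal.mem_span_singleton]
    refine (adicCompletionIntegers.integers (R := 𝓞 K) (K := K) v).dvd_of_le ?_
    rw [map_pow, map_pow]
    refine le_trans (le_of_lt hx) (le_of_eq ?_)
    rw [map_pow]
    rfl

/-- There are no small subgroups of `ℂˣ`. -/
lemma eq_one_of_pow_two_pow_near {z : ℂ} (h : ∀ n : ℕ, ‖z ^ 2 ^ n - 1‖ < 1 / 2) : z = 1 := by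
  -- Squaring `w` multiplies its distance to `1` by `‖w + 1‖`, which is at least `3 / 2` when `w` is
  -- within `1 / 2` of `1`; a nonzero distance would grow without bound.
  have key : ∀ n : ℕ, (3 / 2 : ℝ) ^ n * ‖z - 1‖ ≤ ‖z ^ 2 ^ n - 1‖ := by
    intro n
    induction n with
    | zero => simp
    | succ n ih =>
      set w := z ^ 2 ^ n with hw
      have h1 : z ^ 2 ^ (n + 1) - 1 = (w - 1) * (w + 1) := by
        rw [hw, pow_succ, pow_mul]
        ring
      have h2 : 3 / 2 ≤ ‖w + 1‖ := by
        have h3 : ‖(2 : ℂ)‖ ≤ ‖w + 1‖ + ‖w - 1‖ := by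
          have := norm_sub_le (w + 1) (w - 1)
          rwa [show w + 1 - (w - 1) = 2 by ring] at this
        have h4 := h n
        rw [Complex.norm_ofNat] at h3
        linarith
      rw [h1, norm_mul, pow_succ]
      nlinarith [norm_nonneg (w - 1), norm_nonneg (z - 1)]
  by_contra hz
  have hpos : 0 < ‖z - 1‖ := norm_pos_iff.mpr (sub_ne_zero.mpr hz)
  obtain ⟨n, hn⟩ := pow_unbounded_of_one_lt (1 / ‖z - 1‖) (show (1 : ℝ) < 3 / 2 by norm_num)
  rw [div_lt_iff₀ hpos] at hn
  linarith [key n, h n]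

/-- The radical of a continuous character contains a power of the maximal ideal. -/
lemma exists_pow_le_rad {ψ : AddChar (LocalRing K v) ℂ} (hψ : Continuous ψ) :
    ∃ i, maximalIdeal (LocalRing K v) ^ i ≤ rad ψ := by
  have hU : ψ ⁻¹' Metric.ball 1 (1 / 2) ∈ nhds 0 := by
    refine hψ.continuousAt.preimage_mem_nhds ?_
    rw [ψ.map_zero_eq_one]
    exact Metric.ball_mem_nhds _ (by norm_num)
  obtain ⟨i, hi⟩ := exists_pow_maximalIdeal_subset hU
  refine ⟨i, le_rad_iff.mpr fun a ha => eq_one_of_pow_two_pow_near fun n => ?_⟩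
  rw [← AddChar.map_nsmul_eq_pow, ← dist_eq_norm]
  exact hi (nsmul_mem ha _)

lemma isOpen_rad_and_finite (ψ : AddChar (LocalRing K v) ℂ) (hψ : Continuous ψ) :
    IsOpen (rad ψ : Set (LocalRing K v)) ∧ Finite (LocalRing K v ⧸ rad ψ) := by
  obtain ⟨i, hi⟩ := exists_pow_le_rad hψ
  refine ⟨?_, finite_quot_of_le hi⟩
  exact AddSubgroup.isOpen_mono (H₁ := (maximalIdeal (LocalRing K v) ^ i).toAddSubgroup)
    (H₂ := (rad ψ).toAddSubgroup) hi (isOpen_pow_maximalIdeal i)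

/-- A radical of finite index is a power of the maximal ideal, hence open, so `ψ` is locally
constant. Thus the continuity condition drops out of the count of twist-isoclasses. -/
lemma continuous_of_finite_quot_rad {ψ : AddChar (LocalRing K v) ℂ}
    (hψ : Finite (LocalRing K v ⧸ rad ψ)) : Continuous ψ := by
  obtain ⟨i, -, hi⟩ := (finiteIndexChain_localRing K v).exists_eq _ hψ
  refine (IsLocallyConstant.iff_exists_open _ |>.mpr fun y => ?_).continuous
  refine ⟨(fun z => z - y) ⁻¹' (maximalIdeal (LocalRing K v) ^ i : Ideal _),
    (isOpen_pow_maximalIdeal i).preimage (by fun_prop), by simp, fun z hz => ?_⟩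
  have := apply_eq_of_sub_mem_rad (ψ := ψ) (x := z) (y := y) (hi ▸ hz) 1
  simpa using this

variable (K v)

lemma card_twistClasses {n : ℕ} (hn : n ≠ 0) :
    twistCount (Heisenberg (LocalRing K v)) n =
      Nat.card {ψ : AddChar (LocalRing K v) ℂ // Nat.card (LocalRing K v ⧸ rad ψ) = n} := by
  obtain ⟨e⟩ := nonempty_equiv_twistClasses (R := LocalRing K v) isOpen_rad_and_finite hn
  rw [twistCount, ← Nat.card_congr e]
  refine Nat.card_congr (Equiv.subtypeEquivRight fun ψ => and_iff_right_of_imp fun h => ?_)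
  exact continuous_of_finite_quot_rad (Nat.finite_of_card_ne_zero (h ▸ hn))

lemma twistCount_pow (i : ℕ) : (twistCount (Heisenberg (LocalRing K v)) (residueCard K v ^ i) : ℂ) =
    FiniteIndexChain.powDiff (residueCard K v) i := by
  have hq := one_lt_residueCard K v
  rw [card_twistClasses K v (by positivity)]
  exact (finiteIndexChain_localRing K v).card_rad hq le_top

lemma twistCount_eq_zero {n : ℕ} (hn : n ≠ 0) (hn' : ∀ i, n ≠ residueCard K v ^ i) :
    twistCount (Heisenberg (LocalRing K v)) n = 0 := by
  rw [card_twistClasses K v hn]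
  have : IsEmpty {ψ : AddChar (LocalRing K v) ℂ // Nat.card (LocalRing K v ⧸ rad ψ) = n} := by
    refine ⟨fun ψ => ?_⟩
    obtain ⟨i, -, hi⟩ :=
      (finiteIndexChain_localRing K v).exists_card_quot_eq_pow (ψ.2.trans_ne hn)
    exact hn' i (ψ.2.symm.trans hi)
  exact Nat.card_of_isEmpty

lemma finite_twistClasses {n : ℕ} (hn : n ≠ 0) :
    Finite (TwistClasses (Heisenberg (LocalRing K v)) n) := by
  obtain ⟨e⟩ := nonempty_equiv_twistClasses (R := LocalRing K v) isOpen_rad_and_finite hn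
  refine @Finite.of_equiv _ _ ?_ e
  have h := finiteIndexChain_localRing K v
  have hq := one_lt_residueCard K v
  by_cases hn' : ∃ i, n = residueCard K v ^ i
  · obtain ⟨i, rfl⟩ := hn'
    have hfin : {ψ : AddChar (LocalRing K v) ℂ | maximalIdeal (LocalRing K v) ^ i ≤ rad ψ}.Finite :=
      Set.finite_of_ncard_ne_zero (by rw [h.ncard_le_rad hq le_top]; positivity)
    exact (hfin.subset fun ψ hψ => ((h.card_quot_rad_eq_iff hq le_top _).mp hψ.2).ge).to_subtype
  · have : IsEmpty {ψ : AddChar (LocalRing K v) ℂ //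
        Continuous ψ ∧ Nat.card (LocalRing K v ⧸ rad ψ) = n} := by
      refine ⟨fun ψ => hn' ?_⟩
      obtain ⟨i, -, hi⟩ := h.exists_card_quot_eq_pow (ψ.2.2.trans_ne hn)
      exact ⟨i, ψ.2.2.symm.trans hi⟩
    infer_instance

end Local

/-! ### Dirichlet series supported on powers of `q` -/

section Series

open FiniteIndexChain

lemma natCast_pow_cpow (q i : ℕ) (s : ℂ) : ((q ^ i : ℕ) : ℂ) ^ s = ((q : ℂ) ^ s) ^ i := by
  rw [Nat.cast_pow, ← Complex.natCast_cpow_natCast_mul, Complex.cpow_nat_mul]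

lemma LSeriesHasSum_of_pow {f : ℕ → ℂ} {q : ℕ} (hq : 1 < q) {s a : ℂ}
    (hf : ∀ n ≠ 0, (∀ i, n ≠ q ^ i) → f n = 0)
    (h : HasSum (fun i => f (q ^ i) * ((q : ℂ) ^ (-s)) ^ i) a) : LSeriesHasSum f s a := by
  rw [LSeriesHasSum, ← (Nat.pow_right_injective hq).hasSum_iff]
  · refine h.congr_fun fun i => ?_
    rw [Function.comp_apply, LSeries.term_of_ne_zero (by positivity), natCast_pow_cpow,
      Complex.cpow_neg, inv_pow, div_eq_mul_inv]
  · intro n hn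
    rcases eq_or_ne n 0 with rfl | hn0
    · exact LSeries.term_zero _ _
    · rw [LSeries.term_of_ne_zero hn0, hf n hn0 fun i hi => hn ⟨i, hi.symm⟩, zero_div]

lemma LSeries_eq_sum_of_pow {f : ℕ → ℂ} {q N : ℕ} (hq : 1 < q) (s : ℂ)
    (hf : ∀ n ≠ 0, (∀ i ≤ N, n ≠ q ^ i) → f n = 0) :
    LSeries f s = ∑ i ∈ Finset.range (N + 1), f (q ^ i) * ((q : ℂ) ^ (-s)) ^ i := by
  refine (LSeriesHasSum_of_pow hq (fun n hn h => hf n hn fun i _ => h i) ?_).LSeries_eq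
  refine hasSum_sum_of_ne_finset_zero fun i hi => ?_
  rw [hf _ (by positivity), zero_mul]
  intro j hj h
  rw [Nat.pow_right_injective hq h, Finset.mem_range] at hi
  omega

lemma powDiff_succ_mul (A x : ℂ) (i : ℕ) :
    powDiff A (i + 1) * x ^ (i + 1) = (A * x) ^ i * ((A - 1) * x) := by
  rw [powDiff]
  ring

lemma summable_norm_powDiff {A x : ℂ} (h : ‖A * x‖ < 1) :
    Summable fun i => ‖powDiff A i * x ^ i‖ := by
  rw [← summable_nat_add_iff 1]
  simp only [powDiff_succ_mul, norm_mul, norm_pow]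
  rw [norm_mul] at h
  exact (summable_geometric_of_lt_one (by positivity) h).mul_right _

lemma one_sub_ne_zero_of_norm_lt {z : ℂ} (h : ‖z‖ < 1) : 1 - z ≠ 0 := by
  intro h0
  rw [← sub_eq_zero.mp h0, norm_one] at h
  exact lt_irrefl _ h

lemma hasSum_powDiff {A x : ℂ} (h : ‖A * x‖ < 1) :
    HasSum (fun i => powDiff A i * x ^ i) ((1 - x) / (1 - A * x)) := by
  rw [← hasSum_nat_add_iff' 1]
  refine HasSum.congr_fun ?_ (fun i => powDiff_succ_mul A x i)
  have h1 := one_sub_ne_zero_of_norm_lt h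
  -- The term at `0` is exceptional, since `powDiff` is `1` there; the remaining terms form a
  -- geometric series with ratio `A * x`.
  have h2 : (1 - x) / (1 - A * x) - ∑ i ∈ Finset.range 1, powDiff A i * x ^ i =
      (1 - A * x)⁻¹ * ((A - 1) * x) := by
    rw [Finset.range_one, Finset.sum_singleton, powDiff, pow_zero, mul_one, div_sub_one h1,
      inv_mul_eq_div]
    congr 1
    ring
  rw [h2]
  exact (hasSum_geometric_of_norm_lt_one h).mul_right ((A - 1) * x)

/-- The generating function of the Cauchy product of `powDiff` with a geometric series. -/
lemma hasSum_cauchy {A B U T : ℂ} (h : ‖A * (U * T)‖ < 1) (h' : ‖B * T‖ < 1) :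
    HasSum (fun N => (∑ i ∈ Finset.range (N + 1), powDiff A i * B ^ (N - i) * U ^ i) * T ^ N)
      ((1 - U * T) / ((1 - A * (U * T)) * (1 - B * T))) := by
  have h1 := summable_norm_powDiff h
  have h2 : Summable fun j => ‖(B * T) ^ j‖ := by
    simp only [norm_pow]
    exact summable_geometric_of_lt_one (norm_nonneg _) h'
  have h3 := tsum_mul_tsum_eq_tsum_sum_range_of_summable_norm h1 h2
  have h4 := (summable_norm_sum_mul_range_of_summable_norm h1 h2).of_norm
  rw [(hasSum_powDiff h).tsum_eq, (hasSum_geometric_of_norm_lt_one h').tsum_eq] at h3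
  have h5 := h4.hasSum
  rw [← h3, ← div_eq_mul_inv, div_div] at h5
  refine h5.congr_fun fun N => ?_
  rw [Finset.sum_mul]
  refine Finset.sum_congr rfl fun i hi => ?_
  have hi' : i ≤ N := Nat.lt_succ_iff.mp (Finset.mem_range.mp hi)
  have : T ^ N = T ^ i * T ^ (N - i) := by rw [← pow_add, Nat.add_sub_cancel' hi']
  rw [this]
  ring

end Series

/-! ### The zeta functions of the Heisenberg group -/

section Zeta

open FiniteIndexChain IsDedekindDomain IsLocalRing

variable (K : Type*) [Field K] [NumberField K] (v : HeightOneSpectrum (𝓞 K))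

lemma zetaIrr_heisenbergMod (N : ℕ) (s : ℂ) :
    zetaIrr (HeisenbergMod K v N) s = ∑ i ∈ Finset.range (N + 1),
      powDiff (residueCard K v) i * ((residueCard K v : ℂ) ^ 2) ^ (N - i) *
        ((residueCard K v : ℂ) ^ (-s)) ^ i := by
  have h := finiteIndexChain_quot K v N
  have hq := one_lt_residueCard K v
  rw [zetaIrr, LSeries_eq_sum_of_pow (N := N) hq]
  · refine Finset.sum_congr rfl fun i hi => ?_
    rw [h.irrCount_pow hq (Nat.lt_succ_iff.mp (Finset.mem_range.mp hi))]
  · intro n hn hn'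
    rw [h.irrCount_eq_zero hn hn', Nat.cast_zero]

lemma zetaCC_heisenbergMod (N : ℕ) (s : ℂ) :
    zetaCC (HeisenbergMod K v N) s = ∑ i ∈ Finset.range (N + 1),
      powDiff ((residueCard K v : ℂ) ^ 2) i * (residueCard K v : ℂ) ^ (N - i) *
        ((residueCard K v : ℂ) ^ (-s)) ^ i := by
  have h := finiteIndexChain_quot K v N
  have hq := one_lt_residueCard K v
  rw [zetaCC, LSeries_eq_sum_of_pow (N := N) hq]
  · refine Finset.sum_congr rfl fun i hi => ?_
    rw [h.ccCount_pow hq (Nat.lt_succ_iff.mp (Finset.mem_range.mp hi))]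
  · intro n hn hn'
    rw [h.ccCount_eq_zero hq hn hn', Nat.cast_zero]

variable {K v}

lemma norm_cpow_lt_one {z : ℂ} (hz : z.re < 0) : ‖(residueCard K v : ℂ) ^ z‖ < 1 := by
  have hq := one_lt_residueCard K v
  rw [Complex.norm_natCast_cpow_of_pos (by omega)]
  exact Real.rpow_lt_one_of_one_lt_of_neg (by exact_mod_cast hq) hz

lemma residueCard_ne_zero : (residueCard K v : ℂ) ≠ 0 :=
  Nat.cast_ne_zero.mpr (by have := one_lt_residueCard K v; omega)

variable (K v)

lemma cpow_neg_sub (s₁ s₂ : ℂ) : (residueCard K v : ℂ) ^ (-s₁ - s₂) =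
    (residueCard K v : ℂ) ^ (-s₁) * (residueCard K v : ℂ) ^ (-s₂) := by
  rw [sub_eq_add_neg, Complex.cpow_add _ _ residueCard_ne_zero]

lemma cpow_one_sub (s : ℂ) : (residueCard K v : ℂ) ^ (1 - s) =
    (residueCard K v : ℂ) * (residueCard K v : ℂ) ^ (-s) := by
  rw [sub_eq_add_neg, Complex.cpow_add _ _ residueCard_ne_zero, Complex.cpow_one]

lemma cpow_two_sub (s : ℂ) : (residueCard K v : ℂ) ^ (2 - s) =
    (residueCard K v : ℂ) ^ 2 * (residueCard K v : ℂ) ^ (-s) := by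
  rw [sub_eq_add_neg, Complex.cpow_add _ _ residueCard_ne_zero, Complex.cpow_ofNat]

lemma cpow_one_sub_sub (s₁ s₂ : ℂ) : (residueCard K v : ℂ) ^ (1 - s₁ - s₂) =
    (residueCard K v : ℂ) * ((residueCard K v : ℂ) ^ (-s₁) * (residueCard K v : ℂ) ^ (-s₂)) := by
  rw [← cpow_neg_sub, show (1 : ℂ) - s₁ - s₂ = 1 - (s₁ + s₂) by ring, cpow_one_sub]
  congr 2
  ring

lemma cpow_two_sub_sub (s₁ s₂ : ℂ) : (residueCard K v : ℂ) ^ (2 - s₁ - s₂) =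
    (residueCard K v : ℂ) ^ 2 *
      ((residueCard K v : ℂ) ^ (-s₁) * (residueCard K v : ℂ) ^ (-s₂)) := by
  rw [← cpow_neg_sub, show (2 : ℂ) - s₁ - s₂ = 2 - (s₁ + s₂) by ring, cpow_two_sub]
  congr 2
  ring

lemma hasSum_irrTerm {s₁ s₂ : ℂ} (h2 : 2 < s₂.re) (h1 : 1 < (s₁ + s₂).re) :
    HasSum (irrTerm K v s₁ s₂) ((1 - (residueCard K v : ℂ) ^ (-s₁ - s₂)) /
      ((1 - (residueCard K v : ℂ) ^ (1 - s₁ - s₂)) * (1 - (residueCard K v : ℂ) ^ (2 - s₂)))) := by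
  have n1 : ‖(residueCard K v : ℂ) ^ (1 - s₁ - s₂)‖ < 1 :=
    norm_cpow_lt_one (by simp at h1 ⊢; linarith)
  have n2 : ‖(residueCard K v : ℂ) ^ (2 - s₂)‖ < 1 := norm_cpow_lt_one (by simp; linarith)
  rw [cpow_one_sub_sub] at n1 ⊢
  rw [cpow_two_sub] at n2 ⊢
  rw [cpow_neg_sub]
  -- Here `A = q`, `B = q ^ 2`, `U = q ^ (-s₁)` and `T = q ^ (-s₂)`; for conjugacy classes `A` and
  -- `B` trade places.
  refine (hasSum_cauchy n1 n2).congr_fun fun N => ?_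
  rw [irrTerm, zetaIrr_heisenbergMod, neg_mul, ← mul_neg, Complex.cpow_nat_mul]

lemma hasSum_ccTerm {s₁ s₂ : ℂ} (h2 : 1 < s₂.re) (h1 : 2 < (s₁ + s₂).re) :
    HasSum (ccTerm K v s₁ s₂) ((1 - (residueCard K v : ℂ) ^ (-s₁ - s₂)) /
      ((1 - (residueCard K v : ℂ) ^ (1 - s₂)) * (1 - (residueCard K v : ℂ) ^ (2 - s₁ - s₂)))) := by
  have n1 : ‖(residueCard K v : ℂ) ^ (2 - s₁ - s₂)‖ < 1 :=
    norm_cpow_lt_one (by simp at h1 ⊢; linarith)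
  have n2 : ‖(residueCard K v : ℂ) ^ (1 - s₂)‖ < 1 := norm_cpow_lt_one (by simp; linarith)
  rw [cpow_two_sub_sub] at n1 ⊢
  rw [cpow_one_sub] at n2 ⊢
  rw [cpow_neg_sub, mul_comm (1 - _)]
  refine (hasSum_cauchy n1 n2).congr_fun fun N => ?_
  rw [ccTerm, zetaCC_heisenbergMod, neg_mul, ← mul_neg, Complex.cpow_nat_mul]

lemma ccTerm_zero (s : ℂ) : ccTerm K v 0 s = classTerm K v s := by
  funext N
  have : Finite (HeisenbergMod K v N) := inferInstance
  rw [ccTerm, classTerm, zetaCC_zero]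

lemma hasSum_classTerm {s : ℂ} (hs : 2 < s.re) :
    HasSum (classTerm K v s) ((1 - (residueCard K v : ℂ) ^ (-s)) /
      ((1 - (residueCard K v : ℂ) ^ (1 - s)) * (1 - (residueCard K v : ℂ) ^ (2 - s)))) := by
  have := hasSum_ccTerm K v (s₁ := 0) (s₂ := s) (by linarith) (by simpa using hs)
  rw [ccTerm_zero] at this
  simpa using this

lemma hasSum_twist {s : ℂ} (hs : 1 < s.re) :
    LSeriesHasSum (fun n => (twistCount (Heisenberg (LocalRing K v)) n : ℂ)) s
      ((1 - (residueCard K v : ℂ) ^ (-s)) / (1 - (residueCard K v : ℂ) ^ (1 - s))) := by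
  have n1 : ‖(residueCard K v : ℂ) ^ (1 - s)‖ < 1 := norm_cpow_lt_one (by simp; linarith)
  rw [cpow_one_sub] at n1 ⊢
  refine LSeriesHasSum_of_pow (one_lt_residueCard K v) (fun n hn hn' => ?_) ?_
  · rw [twistCount_eq_zero K v hn hn', Nat.cast_zero]
  · simp only [twistCount_pow]
    exact hasSum_powDiff n1

/-- For `Re s₂ > 2` the prefactor cancels the factor of the denominator that vanishes at `s₂ = 2`.
What remains is continuous there, because `Re s > 1` keeps the other factor nonzero. -/
lemma tendsto_bivariateIrr {s : ℂ} (hs : 1 < s.re) :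
    Filter.Tendsto
      (fun s₂ : ℂ => (1 - (residueCard K v : ℂ) ^ (2 - s₂)) * bivariateIrr K v (s - 2) s₂)
      (nhdsWithin 2 {s₂ : ℂ | 2 < s₂.re})
      (nhds ((1 - (residueCard K v : ℂ) ^ (-s)) / (1 - (residueCard K v : ℂ) ^ (1 - s)))) := by
  have hq : (residueCard K v : ℂ) ≠ 0 := residueCard_ne_zero
  have hcont : ∀ c : ℂ, Continuous fun s₂ : ℂ => 1 - (residueCard K v : ℂ) ^ (c - s₂) := fun c =>
    continuous_const.sub ((continuous_const.sub continuous_id).const_cpow (.inl hq))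
  have n1 : ‖(residueCard K v : ℂ) ^ (3 - s - 2)‖ < 1 :=
    norm_cpow_lt_one (by simp; linarith)
  have key : Filter.Tendsto (fun s₂ : ℂ => (1 - (residueCard K v : ℂ) ^ (2 - s - s₂)) /
      (1 - (residueCard K v : ℂ) ^ (3 - s - s₂))) (nhds 2)
      (nhds ((1 - (residueCard K v : ℂ) ^ (2 - s - 2)) /
        (1 - (residueCard K v : ℂ) ^ (3 - s - 2)))) :=
    ((hcont _).tendsto 2).div ((hcont _).tendsto 2) (one_sub_ne_zero_of_norm_lt n1)
  rw [show 2 - s - 2 = -s by ring, show 3 - s - 2 = 1 - s by ring] at key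
  refine (key.mono_left nhdsWithin_le_nhds).congr' ?_
  filter_upwards [self_mem_nhdsWithin] with s₂ (hs₂ : 2 < s₂.re)
  have n2 : ‖(residueCard K v : ℂ) ^ (2 - s₂)‖ < 1 := norm_cpow_lt_one (by simp; linarith)
  have n2' := one_sub_ne_zero_of_norm_lt n2
  rw [bivariateIrr, (hasSum_irrTerm K v hs₂ (by simp; linarith)).tsum_eq,
    show -(s - 2) - s₂ = 2 - s - s₂ by ring, show 1 - (s - 2) - s₂ = 3 - s - s₂ by ring,
    mul_div_assoc', mul_comm (1 - _), mul_div_mul_right _ _ n2']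

end Zeta

/-! ### Rational functions -/

section Rational

open MvPolynomial

/-- A nonzero constant term certifies that a polynomial is nonzero; the denominators all have
constant term `1`. -/
lemma ne_zero_of_eq_algebraMap {n : ℕ} {P : MvPolynomial (Fin n) ℚ} {W : RatFun n}
    (h : eval 0 P ≠ 0) (hW : W = algebraMap _ (RatFun n) P) : W ≠ 0 := by
  rw [hW, Ne, FaithfulSMul.algebraMap_eq_zero_iff]
  rintro rfl
  exact h (map_zero _)

lemma var_ne_zero {n : ℕ} (i : Fin n) : (var i : RatFun n) ≠ 0 := by
  rw [var, Ne, FaithfulSMul.algebraMap_eq_zero_iff]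
  exact X_ne_zero i

variable {F : Type*} [Field F] [Algebra ℚ F]

lemma hasValueAt_ratIrr (a : Fin 3 → F) (h1 : 1 - a 0 * a 1 * a 2 ≠ 0)
    (h2 : 1 - a 0 ^ 2 * a 2 ≠ 0) :
    HasValueAt ratIrr a
      ((1 - a 1 * a 2) / ((1 - a 0 * a 1 * a 2) * (1 - a 0 ^ 2 * a 2))) := by
  refine ⟨1 - X 1 * X 2, (1 - X 0 * X 1 * X 2) * (1 - X 0 ^ 2 * X 2), ?_, ?_, ?_⟩
  · simpa using ⟨h1, h2⟩
  · simp [ratIrr, var]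
  · simp

lemma hasValueAt_ratCC (a : Fin 3 → F) (h1 : 1 - a 0 * a 2 ≠ 0)
    (h2 : 1 - a 0 ^ 2 * a 1 * a 2 ≠ 0) :
    HasValueAt ratCC a
      ((1 - a 1 * a 2) / ((1 - a 0 * a 2) * (1 - a 0 ^ 2 * a 1 * a 2))) := by
  refine ⟨1 - X 1 * X 2, (1 - X 0 * X 2) * (1 - X 0 ^ 2 * X 1 * X 2), ?_, ?_, ?_⟩
  · simpa using ⟨h1, h2⟩
  · simp [ratCC, var]
  · simp

lemma hasValueAt_ratClass (a : Fin 2 → F) (h1 : 1 - a 0 * a 1 ≠ 0)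
    (h2 : 1 - a 0 ^ 2 * a 1 ≠ 0) :
    HasValueAt ratClass a ((1 - a 1) / ((1 - a 0 * a 1) * (1 - a 0 ^ 2 * a 1))) := by
  refine ⟨1 - X 1, (1 - X 0 * X 1) * (1 - X 0 ^ 2 * X 1), ?_, ?_, ?_⟩
  · simpa using ⟨h1, h2⟩
  · simp [ratClass, var]
  · simp

lemma one_sub_inv_ne_zero {F : Type*} [Field F] {z w : F} (h : 1 - z ≠ 0) (hw : w = z⁻¹) : 1 - w ≠ 0 := by
  rw [hw, sub_ne_zero, ne_comm, Ne, inv_eq_one]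
  exact fun h' => h (by rw [h', sub_self])

lemma ratIrr_functional_equation :
    HasValueAt ratIrr (fun i => (var i : RatFun 3)⁻¹) (-(var 0 ^ 3 * var 2) * ratIrr) := by
  have h0 := var_ne_zero (0 : Fin 3)
  have h1 := var_ne_zero (1 : Fin 3)
  have h2 := var_ne_zero (2 : Fin 3)
  have e1 : (1 : RatFun 3) - var 0 * var 1 * var 2 ≠ 0 :=
    ne_zero_of_eq_algebraMap (P := 1 - X 0 * X 1 * X 2) (by simp) (by simp [var])
  have e2 : (1 : RatFun 3) - var 0 ^ 2 * var 2 ≠ 0 :=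
    ne_zero_of_eq_algebraMap (P := 1 - X 0 ^ 2 * X 2) (by simp) (by simp [var])
  -- Inverting the variables inverts the monomial in each denominator factor, and `1 - z⁻¹` vanishes
  -- only when `1 - z` does; the substitution is therefore defined.
  have d1 := one_sub_inv_ne_zero (w := (var 0 : RatFun 3)⁻¹ * (var 1)⁻¹ * (var 2)⁻¹)
    e1 (by simp only [mul_inv])
  have d2 := one_sub_inv_ne_zero (w := ((var 0 : RatFun 3)⁻¹) ^ 2 * (var 2)⁻¹)
    e2 (by simp only [mul_inv, inv_pow])
  convert hasValueAt_ratIrr (fun i => (var i : RatFun 3)⁻¹) d1 d2 using 1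
  rw [ratIrr, mul_div_assoc', div_eq_div_iff (mul_ne_zero e1 e2) (mul_ne_zero d1 d2)]
  field_simp
  ring

lemma ratCC_functional_equation :
    HasValueAt ratCC (fun i => (var i : RatFun 3)⁻¹) (-(var 0 ^ 3 * var 2) * ratCC) := by
  have h0 := var_ne_zero (0 : Fin 3)
  have h1 := var_ne_zero (1 : Fin 3)
  have h2 := var_ne_zero (2 : Fin 3)
  have e1 : (1 : RatFun 3) - var 0 * var 2 ≠ 0 :=
    ne_zero_of_eq_algebraMap (P := 1 - X 0 * X 2) (by simp) (by simp [var])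
  have e2 : (1 : RatFun 3) - var 0 ^ 2 * var 1 * var 2 ≠ 0 :=
    ne_zero_of_eq_algebraMap (P := 1 - X 0 ^ 2 * X 1 * X 2) (by simp) (by simp [var])
  have d1 := one_sub_inv_ne_zero (w := (var 0 : RatFun 3)⁻¹ * (var 2)⁻¹)
    e1 (by simp only [mul_inv])
  have d2 := one_sub_inv_ne_zero (w := ((var 0 : RatFun 3)⁻¹) ^ 2 * (var 1)⁻¹ * (var 2)⁻¹)
    e2 (by simp only [mul_inv, inv_pow])
  convert hasValueAt_ratCC (fun i => (var i : RatFun 3)⁻¹) d1 d2 using 1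
  rw [ratCC, mul_div_assoc', div_eq_div_iff (mul_ne_zero e1 e2) (mul_ne_zero d1 d2)]
  field_simp
  ring

lemma ratClass_functional_equation :
    HasValueAt ratClass (fun i => (var i : RatFun 2)⁻¹) (-(var 0 ^ 3 * var 1) * ratClass) := by
  have h0 := var_ne_zero (0 : Fin 2)
  have h1 := var_ne_zero (1 : Fin 2)
  have e1 : (1 : RatFun 2) - var 0 * var 1 ≠ 0 :=
    ne_zero_of_eq_algebraMap (P := 1 - X 0 * X 1) (by simp) (by simp [var])
  have e2 : (1 : RatFun 2) - var 0 ^ 2 * var 1 ≠ 0 :=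
    ne_zero_of_eq_algebraMap (P := 1 - X 0 ^ 2 * X 1) (by simp) (by simp [var])
  have d1 := one_sub_inv_ne_zero (w := (var 0 : RatFun 2)⁻¹ * (var 1)⁻¹)
    e1 (by simp only [mul_inv])
  have d2 := one_sub_inv_ne_zero (w := ((var 0 : RatFun 2)⁻¹) ^ 2 * (var 1)⁻¹)
    e2 (by simp only [mul_inv, inv_pow])
  convert hasValueAt_ratClass (fun i => (var i : RatFun 2)⁻¹) d1 d2 using 1
  rw [ratClass, mul_div_assoc', div_eq_div_iff (mul_ne_zero e1 e2) (mul_ne_zero d1 d2)]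
  field_simp
  ring

end Rational

/-! ### The rational functions evaluated at powers of `q` -/

section Values

variable (K : Type*) [Field K] [NumberField K] (v : IsDedekindDomain.HeightOneSpectrum (𝓞 K))

lemma hasValueAt_ratIrr_cpow {s₁ s₂ : ℂ} (h2 : 2 < s₂.re) (h1 : 1 < (s₁ + s₂).re) :
    HasValueAt ratIrr ![(residueCard K v : ℂ), (residueCard K v : ℂ) ^ (-s₁),
      (residueCard K v : ℂ) ^ (-s₂)] ((1 - (residueCard K v : ℂ) ^ (-s₁ - s₂)) /
      ((1 - (residueCard K v : ℂ) ^ (1 - s₁ - s₂)) * (1 - (residueCard K v : ℂ) ^ (2 - s₂)))) := by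
  have n1 : ‖(residueCard K v : ℂ) ^ (1 - s₁ - s₂)‖ < 1 :=
    norm_cpow_lt_one (by simp at h1 ⊢; linarith)
  have n2 : ‖(residueCard K v : ℂ) ^ (2 - s₂)‖ < 1 := norm_cpow_lt_one (by simp; linarith)
  rw [cpow_one_sub_sub, ← mul_assoc] at n1 ⊢
  rw [cpow_two_sub] at n2 ⊢
  rw [cpow_neg_sub]
  exact hasValueAt_ratIrr ![_, _, _] (one_sub_ne_zero_of_norm_lt n1) (one_sub_ne_zero_of_norm_lt n2)

lemma hasValueAt_ratCC_cpow {s₁ s₂ : ℂ} (h2 : 1 < s₂.re) (h1 : 2 < (s₁ + s₂).re) :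
    HasValueAt ratCC ![(residueCard K v : ℂ), (residueCard K v : ℂ) ^ (-s₁),
      (residueCard K v : ℂ) ^ (-s₂)] ((1 - (residueCard K v : ℂ) ^ (-s₁ - s₂)) /
      ((1 - (residueCard K v : ℂ) ^ (1 - s₂)) * (1 - (residueCard K v : ℂ) ^ (2 - s₁ - s₂)))) := by
  have n1 : ‖(residueCard K v : ℂ) ^ (2 - s₁ - s₂)‖ < 1 :=
    norm_cpow_lt_one (by simp at h1 ⊢; linarith)
  have n2 : ‖(residueCard K v : ℂ) ^ (1 - s₂)‖ < 1 := norm_cpow_lt_one (by simp; linarith)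
  rw [cpow_two_sub_sub, ← mul_assoc] at n1 ⊢
  rw [cpow_one_sub] at n2 ⊢
  rw [cpow_neg_sub]
  exact hasValueAt_ratCC ![_, _, _] (one_sub_ne_zero_of_norm_lt n2) (one_sub_ne_zero_of_norm_lt n1)

lemma hasValueAt_ratClass_cpow {s : ℂ} (hs : 2 < s.re) :
    HasValueAt ratClass ![(residueCard K v : ℂ), (residueCard K v : ℂ) ^ (-s)]
      ((1 - (residueCard K v : ℂ) ^ (-s)) /
      ((1 - (residueCard K v : ℂ) ^ (1 - s)) * (1 - (residueCard K v : ℂ) ^ (2 - s)))) := by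
  have n1 : ‖(residueCard K v : ℂ) ^ (1 - s)‖ < 1 := norm_cpow_lt_one (by simp; linarith)
  have n2 : ‖(residueCard K v : ℂ) ^ (2 - s)‖ < 1 := norm_cpow_lt_one (by simp; linarith)
  rw [cpow_one_sub] at n1 ⊢
  rw [cpow_two_sub] at n2 ⊢
  exact hasValueAt_ratClass ![_, _] (one_sub_ne_zero_of_norm_lt n1) (one_sub_ne_zero_of_norm_lt n2)

end Values

end

end HeisenbergZeta

theorem mainTheorem6 (K : Type*) [Field K] [NumberField K]
    (v : IsDedekindDomain.HeightOneSpectrum (𝓞 K)) (q : ℂ) (hq : q = (residueCard K v : ℂ)) :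
    -- the bivariate representation zeta function
    (∀ s₁ s₂ : ℂ, 2 < s₂.re → 1 < (s₁ + s₂).re →
      Summable (irrTerm K v s₁ s₂) ∧
      bivariateIrr K v s₁ s₂ =
        (1 - q ^ (-s₁ - s₂)) / ((1 - q ^ (1 - s₁ - s₂)) * (1 - q ^ (2 - s₂))) ∧
      HasValueAt ratIrr ![q, q ^ (-s₁), q ^ (-s₂)] (bivariateIrr K v s₁ s₂)) ∧
    -- the bivariate conjugacy class zeta function
    (∀ s₁ s₂ : ℂ, 1 < s₂.re → 2 < (s₁ + s₂).re →
      Summable (ccTerm K v s₁ s₂) ∧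
      bivariateCC K v s₁ s₂ =
        (1 - q ^ (-s₁ - s₂)) / ((1 - q ^ (1 - s₂)) * (1 - q ^ (2 - s₁ - s₂))) ∧
      HasValueAt ratCC ![q, q ^ (-s₁), q ^ (-s₂)] (bivariateCC K v s₁ s₂)) ∧
    -- the class number zeta function, as a specialisation of both
    (∀ s : ℂ, 2 < s.re →
      Summable (classTerm K v s) ∧
      bivariateIrr K v 0 s = classZeta K v s ∧
      bivariateCC K v 0 s = classZeta K v s ∧
      classZeta K v s = (1 - q ^ (-s)) / ((1 - q ^ (1 - s)) * (1 - q ^ (2 - s))) ∧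
      HasValueAt ratClass ![q, q ^ (-s)] (classZeta K v s)) ∧
    -- the twist representation zeta function
    (∀ n : ℕ, 1 ≤ n → Finite (TwistClasses (Heisenberg (LocalRing K v)) n)) ∧
    (∀ s : ℂ, 1 < s.re →
      LSeriesSummable (fun n => (twistCount (Heisenberg (LocalRing K v)) n : ℂ)) s ∧
      twistZeta (Heisenberg (LocalRing K v)) s = (1 - q ^ (-s)) / (1 - q ^ (1 - s)) ∧
      Filter.Tendsto (fun s₂ : ℂ => (1 - q ^ (2 - s₂)) * bivariateIrr K v (s - 2) s₂)
        (nhdsWithin 2 {s₂ : ℂ | 2 < s₂.re}) (nhds (twistZeta (Heisenberg (LocalRing K v)) s))) ∧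
    -- the functional equations under inversion of all variables
    HasValueAt ratIrr (fun i => (var i)⁻¹) (-(var 0 ^ 3 * var 2) * ratIrr) ∧
    HasValueAt ratCC (fun i => (var i)⁻¹) (-(var 0 ^ 3 * var 2) * ratCC) ∧
    HasValueAt ratClass (fun i => (var i)⁻¹) (-(var 0 ^ 3 * var 1) * ratClass) := by
  subst hq
  refine ⟨fun s₁ s₂ h2 h1 => ?_, fun s₁ s₂ h2 h1 => ?_, fun s hs => ?_,
    fun n hn => finite_twistClasses K v (by omega), fun s hs => ?_,
    ratIrr_functional_equation, ratCC_functional_equation, ratClass_functional_equation⟩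
  · have h := hasSum_irrTerm K v h2 h1
    have he : bivariateIrr K v s₁ s₂ = _ := h.tsum_eq
    exact ⟨h.summable, he, he ▸ hasValueAt_ratIrr_cpow K v h2 h1⟩
  · have h := hasSum_ccTerm K v h2 h1
    have he : bivariateCC K v s₁ s₂ = _ := h.tsum_eq
    exact ⟨h.summable, he, he ▸ hasValueAt_ratCC_cpow K v h2 h1⟩
  · have h := hasSum_classTerm K v hs
    have he : classZeta K v s = _ := h.tsum_eq
    have hirr : bivariateIrr K v 0 s = _ :=
      (hasSum_irrTerm K v hs (by rw [zero_add]; linarith)).tsum_eq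
    refine ⟨h.summable, ?_, ?_, he, he ▸ hasValueAt_ratClass_cpow K v hs⟩
    -- At `s₁ = 0` the two closed forms coincide, so the equality of the numbers of irreducible
    -- representations and of classes is not invoked.
    · rw [hirr, he, neg_zero, zero_sub, sub_zero]
    · rw [bivariateCC, ccTerm_zero, classZeta]
  · have h := hasSum_twist K v hs
    have he : twistZeta (Heisenberg (LocalRing K v)) s = _ := h.LSeries_eq
    exact ⟨h.LSeriesSummable, he, he ▸ tendsto_bivariateIrr K v hs⟩
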